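/- Let $\eta(\tau)=e^{2\pi i\tau/24}\prod_{n\ge 1}(1-e^{2\pi i n\tau})$ be the Dedekind eta function on the upper half plane, and for a function $f$ on the upper half plane put $$L(f,s)=\frac{(2\pi)^s}{\Gamma(s)}\int_0^\infty f(ix)\,x^{s}\,\frac{dx}{x}$$ whenever the integral converges absolutely. Let $(a)_n=a(a+1)\cdots(a+n-1)$, and let $${}_pF_q(a_1,\dots,a_p;b_1,\dots,b_q;z)=\sum_{n\ge 0}\frac{(a_1)_n\cdots(a_p)_n}{(b_1)_n\cdots(b_q)_n}\frac{z^n}{n!}$$ be the generalized hypergeometric series. Then, for $f(\tau)=\eta(2\tau)^{12}$, the integral defining $L(f,5)$ and both series below converge absolutely, and $$L(f,5)=\frac{\pi^6}{1024}\sum_{n\ge 0}\frac{(\frac12)_n^8}{(1)_n^8}(1+4n)=\frac{\pi^6}{1024}\;{}_9F_8\!\left(\tfrac12,\tfrac12,\tfrac12,\tfrac12,\tfrac12,\tfrac12,\tfrac12,\tfrac12,\tfrac54;\;1,1,1,1,1,1,1,\tfrac14;\;1\right).$$ -/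

import Mathlib

open UpperHalfPlane hiding I
open scoped Real Nat

noncomputable section

/-- The function `τ ↦ η(2τ)¹²` on the upper half plane, with `η` the Dedekind eta function. -/
def etaTwoPowTwelve (τ : ℍ) : ℂ := ModularForm.eta (2 * (τ : ℂ)) ^ 12

/-- Convergence (absolute integrability) of the integral `∫₀^∞ f(ix) x^s dx/x`. -/
def LIntegralConverges (f : ℍ → ℂ) (s : ℂ) : Prop :=
  MellinConvergent (fun x : ℝ => f (ofComplex (Complex.I * x))) s

/-- The `L`-function `L(f, s) = (2π)^s / Γ(s) * ∫₀^∞ f(ix) x^s dx/x` of a function `f` on the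
upper half plane. For `x > 0`, `ofComplex (I * x)` is the point `ix` of the upper half plane. -/
def LValue (f : ℍ → ℂ) (s : ℂ) : ℂ :=
  (2 * (π : ℂ)) ^ s / Complex.Gamma s *
    mellin (fun x : ℝ => f (ofComplex (Complex.I * x))) s

/-- The rising factorial (Pochhammer symbol) `(a)_n = a (a + 1) ⋯ (a + n - 1)`. -/
def risingFactorial (a : ℂ) (n : ℕ) : ℂ := (ascPochhammer ℂ n).eval a

/-- The `n`-th term `(a₁)_n ⋯ (a_p)_n / ((b₁)_n ⋯ (b_q)_n) * z^n / n!` of the generalized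
hypergeometric series with upper parameters `a` and lower parameters `b`. -/
def hypergeometricTerm (a b : Multiset ℂ) (z : ℂ) (n : ℕ) : ℂ :=
  (a.map fun x => risingFactorial x n).prod / (b.map fun y => risingFactorial y n).prod *
    (z ^ n / (n ! : ℂ))

/-- The generalized hypergeometric series `_pF_q(a; b; z)`. -/
def hypergeometricPFQ (a b : Multiset ℂ) (z : ℂ) : ℂ := ∑' n : ℕ, hypergeometricTerm a b z n

end

noncomputable section

open Filter Set Topology MeasureTheory Asymptotics

/-! ### The series `₂F₁(1/2, 1/2; 1; t)` -/

/-! Write F(t) = ₂F₁(1/2, 1/2; 1; t), W(t) = F(t) F(1 - t) on (0, 1), and M(s) = ∫₀^∞ η(iy)¹²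
y^(s-1) dy. Both sides of the theorem are explicit multiples of ∫₀¹ W².

Series side. F(t) and F(1 - t) solve the same second-order equation, so W solves its symmetric
square, of order three. Paired with the shifted Legendre polynomials, this equation becomes (n+2)⁴
c_(n+2) = (n+1)⁴ c_n for the coefficients c_n = ∫ W Q_n (`integral_ellW_mul_legendreQ_rec`). The
symmetry t ↦ 1 - t kills the odd coefficients, so c_(2n) = ((1/2)_n / n!)⁴ c_0, and c_0 = π/2
(`integral_ellW`). Parseval's identity then gives ∫ W² = (π²/4) ∑ (4n+1) ((1/2)_n / n!)⁸
(`hasSum_halfCoeff_pow_eight`).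

Modular side. Let t = λ(iy). Then θ₃(iy)² = F(t) (`ellF_lambdaIm`), because Landen's transformation
for F matches the arithmetic-geometric mean step that y ↦ 2y induces on θ₃² and θ₄². Inversion gives
y = F(1 - t) / F(t), Legendre's relation gives dy/dt, and η(iy)¹² = t(1 - t)F(t)⁶/16. Substituting
in M(3) gives M(3) = (1/16π) ∫ W² (`etaMellin_three`).

Bridge. The L-value involves M(5) rather than M(3). Invariance of the differential η¹²(τ² - τ + 1)²
dτ under the map τ ↦ 1/(1 - τ) of order three, with Cauchy's theorem, yields the Eichler–Shimura
relation 2 M(5) = 3 M(3) (`two_mul_etaMellin_five`). -/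

theorem hasDerivAt_tsum_mul_pow {c : ℕ → ℝ} (hc : ∀ n, |c n| ≤ 1) {t : ℝ} (ht : |t| < 1) :
    HasDerivAt (fun x => ∑' n, c n * x ^ n) (∑' n, c n * (n * t ^ (n - 1))) t := by
  obtain ⟨r, hr1, hr2⟩ := exists_between ht
  have hr0 : 0 < r := (abs_nonneg t).trans_lt hr1
  have hu : Summable fun n : ℕ => (n : ℝ) * r ^ (n - 1) := by
    have h := summable_pow_mul_geometric_of_norm_lt_one 1 (r := r)
      (by rwa [Real.norm_eq_abs, abs_of_pos hr0])
    refine (h.mul_right r⁻¹).congr fun n => ?_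
    rcases n with _ | n
    · simp
    · simp only [pow_one, Nat.add_sub_cancel]
      field_simp
      ring
  refine hasDerivAt_tsum_of_isPreconnected (t := Metric.ball 0 r) (y₀ := 0)
    (g := fun n x => c n * x ^ n) (g' := fun n x => c n * (n * x ^ (n - 1))) hu Metric.isOpen_ball
    (convex_ball _ _).isPreconnected (fun n y _ => (hasDerivAt_pow n y).const_mul _) ?_
    (by simpa using hr0) ?_ (by simpa using hr1)
  · intro n y hy
    have hy' : |y| < r := by simpa using hy
    rw [Real.norm_eq_abs, abs_mul, abs_mul, abs_pow, Nat.abs_cast]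
    calc |c n| * (n * |y| ^ (n - 1)) ≤ 1 * (n * r ^ (n - 1)) := by gcongr; exact hc n
      _ = _ := one_mul _
  · refine summable_of_ne_finset_zero (s := {0}) fun n hn => ?_
    simp at hn
    simp [hn]

theorem summable_mul_pow {c : ℕ → ℝ} (hc : ∀ n, |c n| ≤ 1) {t : ℝ} (ht : |t| < 1) :
    Summable fun n => c n * t ^ n := by
  refine .of_norm_bounded (summable_geometric_of_abs_lt_one (r := |t|) (by rwa [abs_abs]))
    fun n => ?_
  rw [Real.norm_eq_abs, abs_mul, abs_pow]
  exact mul_le_of_le_one_left (by positivity) (hc n)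

/-- The coefficients `(1/2)_n / n!`. -/
def halfCoeff (n : ℕ) : ℝ := n.centralBinom / 4 ^ n

theorem halfCoeff_zero : halfCoeff 0 = 1 := by simp [halfCoeff]

theorem halfCoeff_pos (n : ℕ) : 0 < halfCoeff n := by
  have := n.centralBinom_pos
  unfold halfCoeff
  positivity

theorem succ_mul_halfCoeff_succ (n : ℕ) :
    (n + 1) * halfCoeff (n + 1) = (n + 1 / 2) * halfCoeff n := by
  have h : ((n : ℝ) + 1) * (n + 1).centralBinom = 2 * (2 * n + 1) * n.centralBinom := by
    exact_mod_cast Nat.succ_mul_centralBinom_succ n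
  unfold halfCoeff
  rw [← mul_div_assoc, h, pow_succ]
  field_simp
  ring

theorem halfCoeff_succ (n : ℕ) :
    halfCoeff (n + 1) = (n + 1 / 2) / (n + 1) * halfCoeff n := by
  have h := succ_mul_halfCoeff_succ n
  field_simp at h ⊢
  linarith

/-- Links the coefficients to the Wallis product, which is where π enters. -/
theorem halfCoeff_sq_mul (n : ℕ) :
    halfCoeff n ^ 2 * (2 * n + 1) * Real.Wallis.W n = 1 := by
  induction n with
  | zero => simp [halfCoeff_zero, Real.Wallis.W]
  | succ n ih =>
    rw [Real.Wallis.W_succ, halfCoeff_succ]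
    refine Eq.trans ?_ ih
    push_cast
    have h1 : (2 * (n : ℝ) + 1) ≠ 0 := by positivity
    have h3 : (2 * (n : ℝ) + 3) ≠ 0 := by positivity
    have h4 : ((n : ℝ) + 1) ≠ 0 := by positivity
    field_simp
    ring

theorem tendsto_halfCoeff_sq_mul :
    Tendsto (fun n : ℕ => n * halfCoeff n ^ 2) atTop (𝓝 (1 / π)) := by
  have h1 : Tendsto (fun n : ℕ => (n : ℝ) / (2 * n + 1)) atTop (𝓝 (1 / 2)) := by
    have : Tendsto (fun n : ℕ => 1 / (2 + 1 / (n : ℝ))) atTop (𝓝 (1 / (2 + 0))) :=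
      tendsto_const_nhds.div (tendsto_const_nhds.add tendsto_one_div_atTop_nhds_zero_nat)
        (by norm_num)
    rw [add_zero] at this
    refine this.congr' ?_
    filter_upwards [eventually_gt_atTop 0] with n hn
    have : (0 : ℝ) < n := by exact_mod_cast hn
    field_simp
  have h2 := h1.mul (Real.Wallis.tendsto_W_nhds_pi_div_two.inv₀ (by positivity))
  refine (h2.congr fun n => ?_).trans_eq (by field_simp)
  have h3 := halfCoeff_sq_mul n
  have h4 := Real.Wallis.W_pos n
  field_simp
  linear_combination (-(n:ℝ)) * h3

theorem halfCoeff_le_one (n : ℕ) : halfCoeff n ≤ 1 := by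
  induction n with
  | zero => simp [halfCoeff_zero]
  | succ n ih =>
    rw [halfCoeff_succ]
    refine mul_le_one₀ ?_ (halfCoeff_pos n).le ih
    rw [div_le_one (by positivity)]
    linarith

theorem halfCoeff_sq_le_one (n : ℕ) : halfCoeff n ^ 2 ≤ 1 :=
  pow_le_one₀ (halfCoeff_pos n).le (halfCoeff_le_one n)

/-- Telescoping: (n+1)a_(n+1)² - n a_n² = a_n²/(4(n+1)). The same difference is the n-th coefficient
of (1 - t)F'(t). Together with the Wallis limit this evaluates the sum as 1/π, and it makes n a_n²
increasing. -/
theorem sum_halfCoeff_sq_div (n : ℕ) :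
    ∑ k ∈ Finset.range n, halfCoeff k ^ 2 / (4 * (k + 1)) = n * halfCoeff n ^ 2 := by
  induction n with
  | zero => simp
  | succ n ih =>
    rw [Finset.sum_range_succ, ih, halfCoeff_succ]
    push_cast
    field_simp
    ring

theorem hasSum_halfCoeff_sq_div :
    HasSum (fun k : ℕ => halfCoeff k ^ 2 / (4 * (k + 1))) (1 / π) := by
  rw [hasSum_iff_tendsto_nat_of_nonneg (fun k => by positivity)]
  simpa only [sum_halfCoeff_sq_div] using tendsto_halfCoeff_sq_mul

theorem mul_halfCoeff_sq_le (n : ℕ) : n * halfCoeff n ^ 2 ≤ 1 := by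
  rw [← sum_halfCoeff_sq_div]
  refine (sum_le_hasSum _ (fun k _ => by positivity) hasSum_halfCoeff_sq_div).trans ?_
  rw [div_le_one Real.pi_pos]
  linarith [Real.pi_gt_three]

/-- The series `₂F₁(1/2, 1/2; 1; t)`, that is, `2 K / π` as a function of the parameter `t = k²`. -/
def ellF (t : ℝ) : ℝ := ∑' n, halfCoeff n ^ 2 * t ^ n

/-- The series `∑ (1/2)_n² / n!² * t ^ n / (4 (n + 1))`, equal to `(1 - t) F'(t)`. -/
def ellG (t : ℝ) : ℝ := ∑' n : ℕ, halfCoeff n ^ 2 / (4 * (n + 1)) * t ^ n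

theorem abs_halfCoeff_sq_le (n : ℕ) : |halfCoeff n ^ 2| ≤ 1 := by
  rw [abs_of_nonneg (by positivity)]
  exact halfCoeff_sq_le_one n

theorem abs_halfCoeff_sq_div_le (n : ℕ) : |halfCoeff n ^ 2 / (4 * ((n : ℝ) + 1))| ≤ 1 := by
  rw [abs_of_nonneg (by positivity), div_le_one (by positivity)]
  have := halfCoeff_sq_le_one n
  have : (0 : ℝ) ≤ n := by positivity
  linarith

theorem hasDerivAt_ellF {t : ℝ} (ht : |t| < 1) : HasDerivAt ellF (ellG t / (1 - t)) t := by
  have h := hasDerivAt_tsum_mul_pow abs_halfCoeff_sq_le ht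
  refine h.congr_deriv ?_
  have hlt : t < 1 := (abs_lt.1 ht).2
  rw [eq_div_iff (by linarith), mul_sub, mul_one]
  have hc : ∀ n : ℕ, |n * halfCoeff n ^ 2| ≤ 1 := fun n => by
    rw [abs_of_nonneg (by positivity)]
    exact mul_halfCoeff_sq_le n
  have hs := summable_mul_pow hc ht
  have hs' := (summable_nat_add_iff 1).2 hs
  have hc1 : ∀ n : ℕ, |((n + 1 : ℕ) : ℝ) * halfCoeff (n + 1) ^ 2| ≤ 1 := fun n => hc (n + 1)
  have hs1 := summable_mul_pow hc1 ht
  have e1 : ∑' n : ℕ, halfCoeff n ^ 2 * (n * t ^ (n - 1))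
      = ∑' n : ℕ, ((n + 1 : ℕ) : ℝ) * halfCoeff (n + 1) ^ 2 * t ^ n := by
    rw [Summable.tsum_eq_zero_add]
    · simp only [Nat.cast_zero, zero_mul, mul_zero, zero_add, Nat.add_sub_cancel]
      exact tsum_congr fun n => by ring
    · rw [← summable_nat_add_iff 1]
      exact hs1.congr fun n => by simp only [Nat.add_sub_cancel]; ring
  have e2 : (∑' n : ℕ, halfCoeff n ^ 2 * (n * t ^ (n - 1))) * t
      = ∑' n : ℕ, (n : ℝ) * halfCoeff n ^ 2 * t ^ n := by
    rw [← tsum_mul_right]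
    refine tsum_congr fun n => ?_
    rcases n with _ | n
    · simp
    · simp only [Nat.add_sub_cancel]; ring
  rw [e2, e1, ← hs1.tsum_sub hs]
  refine tsum_congr fun n => ?_
  rw [halfCoeff_succ]
  push_cast
  field_simp
  ring

/-- With `hasDerivAt_ellF`, this is the hypergeometric equation as a first-order system in F and tG.
Unlike F, the function G stays continuous at 1, which makes boundary values computable. -/
theorem hasDerivAt_mul_ellG {t : ℝ} (ht : |t| < 1) :
    HasDerivAt (fun t => t * ellG t) (ellF t / 4) t := by
  have h := hasDerivAt_tsum_mul_pow abs_halfCoeff_sq_div_le ht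
  refine ((hasDerivAt_id t).mul h).congr_deriv ?_
  have hs := summable_mul_pow abs_halfCoeff_sq_div_le ht
  have e2 : t * (∑' n : ℕ, halfCoeff n ^ 2 / (4 * (n + 1)) * (n * t ^ (n - 1)))
      = ∑' n : ℕ, (n : ℝ) * (halfCoeff n ^ 2 / (4 * (n + 1))) * t ^ n := by
    rw [← tsum_mul_left]
    refine tsum_congr fun n => ?_
    rcases n with _ | n
    · simp
    · simp only [Nat.add_sub_cancel]; ring
  have hc : ∀ n : ℕ, |(n : ℝ) * (halfCoeff n ^ 2 / (4 * ((n : ℝ) + 1)))| ≤ 1 := fun n => by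
    rw [abs_of_nonneg (by positivity), mul_div_assoc', div_le_one (by positivity)]
    have := mul_halfCoeff_sq_le n
    have : (0 : ℝ) ≤ n := by positivity
    linarith
  simp only [id, one_mul]
  rw [e2, ← hs.tsum_add (summable_mul_pow hc ht), ellF, ← tsum_div_const]
  refine tsum_congr fun n => ?_
  field_simp
  ring

theorem continuousOn_ellG : ContinuousOn ellG (Icc 0 1) := by
  refine continuousOn_tsum (u := fun n : ℕ => halfCoeff n ^ 2 / (4 * (n + 1)))
    (fun n => by fun_prop) hasSum_halfCoeff_sq_div.summable fun n x hx => ?_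
  rw [Real.norm_eq_abs, abs_of_nonneg (by have := hx.1; positivity)]
  exact mul_le_of_le_one_right (by positivity) (pow_le_one₀ hx.1 hx.2)

theorem ellG_one : ellG 1 = 1 / π := by
  simpa [ellG] using hasSum_halfCoeff_sq_div.tsum_eq

theorem ellF_zero : ellF 0 = 1 := by
  rw [ellF, tsum_eq_single 0 (fun n hn => by simp [hn])]
  simp [halfCoeff_zero]

theorem one_le_ellF {t : ℝ} (h0 : 0 ≤ t) (h1 : t < 1) : 1 ≤ ellF t := by
  have h := (summable_mul_pow abs_halfCoeff_sq_le (t := t)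
    (by rwa [abs_of_nonneg h0])).le_tsum 0 (fun n _ => by positivity)
  simpa [halfCoeff_zero, ellF] using h

theorem ellF_pos {t : ℝ} (h0 : 0 ≤ t) (h1 : t < 1) : 0 < ellF t :=
  one_pos.trans_le (one_le_ellF h0 h1)

/-- Since n a_n² ≤ 1, the coefficients of F beyond the constant term are dominated by those of
-log(1 - t). -/
theorem ellF_le_one_sub_log {t : ℝ} (h0 : 0 ≤ t) (h1 : t < 1) :
    ellF t ≤ 1 - Real.log (1 - t) := by
  have ht : |t| < 1 := by rwa [abs_of_nonneg h0]
  have hs := summable_mul_pow abs_halfCoeff_sq_le ht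
  have h := Real.hasSum_pow_div_log_of_abs_lt_one ht
  rw [ellF, hs.tsum_eq_zero_add, ← sub_nonneg]
  have hle : ∑' n, halfCoeff (n + 1) ^ 2 * t ^ (n + 1) ≤ -Real.log (1 - t) := by
    rw [← h.tsum_eq]
    refine ((summable_nat_add_iff 1).2 hs).tsum_le_tsum (fun n => ?_) h.summable
    have := mul_halfCoeff_sq_le (n + 1)
    push_cast at this
    rw [div_eq_inv_mul]
    gcongr
    rw [← one_div, le_div_iff₀ (by positivity)]
    linarith
  simp [halfCoeff_zero]
  linarith

/-- Follows from log x ≤ x - 1 at x = (1 - t)^(-1/8). Any small exponent would serve; 1/8 leaves W²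
comfortably integrable. -/
theorem ellF_le_rpow {t : ℝ} (h0 : 0 ≤ t) (h1 : t < 1) :
    ellF t ≤ 8 * (1 - t) ^ (-(1 / 8) : ℝ) := by
  refine (ellF_le_one_sub_log h0 h1).trans ?_
  have hs : 0 < 1 - t := by linarith
  have h := Real.log_le_sub_one_of_pos (Real.rpow_pos_of_pos hs (-(1 / 8)))
  rw [Real.log_rpow hs] at h
  linarith

/-! ### Shifted Legendre polynomials -/

open Polynomial in
/-- The shifted Legendre polynomials `P_n (1 - 2 X)`, defined by the three-term recurrence. -/
def legendreQ : ℕ → Polynomial ℝ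
  | 0 => 1
  | 1 => 1 - 2 * X
  | n + 2 => C ((2 * n + 3) / (n + 2) : ℝ) * ((1 - 2 * X) * legendreQ (n + 1)) -
      C ((n + 1) / (n + 2) : ℝ) * legendreQ n

section
open Polynomial

theorem legendreQ_add_two (n : ℕ) :
    ((n : ℝ[X]) + 2) * legendreQ (n + 2) =
      (2 * (n : ℝ[X]) + 3) * (1 - 2 * X) * legendreQ (n + 1) - ((n : ℝ[X]) + 1) * legendreQ n := by
  have h : ((n : ℝ) + 2) ≠ 0 := by positivity
  have e : ((n : ℝ[X]) + 2) = C ((n : ℝ) + 2) := by simp [map_ofNat C 2]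
  have e1 : (2 * (n : ℝ[X]) + 3) = C (2 * (n : ℝ) + 3) := by simp [map_ofNat C 2, map_ofNat C 3]
  have e2 : ((n : ℝ[X]) + 1) = C ((n : ℝ) + 1) := by simp
  rw [legendreQ, e, e1, e2, mul_sub, ← mul_assoc (C _), ← mul_assoc (C _) (C _), ← C_mul, ← C_mul,
    mul_div_cancel₀ _ h, mul_div_cancel₀ _ h]
  ring

/-- With x = 1 - 2t, the operator (1 - x²) d/dx is -2t(1 - t) d/dt, so these are the classical
derivative formulas. They are proved jointly because differentiating the recurrence brings in the
derivatives of two consecutive polynomials. -/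
theorem legendreQ_derivative_aux (n : ℕ) :
    -2 * (X * (1 - X)) * derivative (legendreQ (n + 1)) =
        ((n : ℝ[X]) + 1) * (legendreQ n - (1 - 2 * X) * legendreQ (n + 1)) ∧
      -2 * (X * (1 - X)) * derivative (legendreQ n) =
        ((n : ℝ[X]) + 1) * ((1 - 2 * X) * legendreQ n - legendreQ (n + 1)) := by
  induction n with
  | zero =>
    constructor
    · simp [legendreQ]
      ring
    · simp [legendreQ]
  | succ n ih =>
    obtain ⟨hA, hB⟩ := ih
    have hr := legendreQ_add_two n
    have hn : ((n : ℝ[X]) + 2) ≠ 0 := by exact_mod_cast (n + 1).succ_ne_zero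
    have hd := congrArg derivative hr
    simp only [derivative_mul, derivative_sub, derivative_add, derivative_natCast, derivative_X,
      derivative_one, derivative_ofNat] at hd
    constructor
    · refine mul_left_cancel₀ hn ?_
      push_cast
      linear_combination (-2 * (X * (1 - X))) * hd + (2 * (n : ℝ[X]) + 3) * (1 - 2 * X) * hA
        - ((n : ℝ[X]) + 1) * hB + ((n : ℝ[X]) + 2) * (1 - 2 * X) * hr
    · push_cast
      linear_combination hA + hr

/-- `x (1 - x²) P_n'`-type formula with the predecessor. -/
theorem legendreQ_succ_derivative (n : ℕ) :
    -2 * (X * (1 - X)) * derivative (legendreQ (n + 1)) =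
        ((n : ℝ[X]) + 1) * (legendreQ n - (1 - 2 * X) * legendreQ (n + 1)) :=
  (legendreQ_derivative_aux n).1

theorem legendreQ_derivative (n : ℕ) :
    -2 * (X * (1 - X)) * derivative (legendreQ n) =
        ((n : ℝ[X]) + 1) * ((1 - 2 * X) * legendreQ n - legendreQ (n + 1)) :=
  (legendreQ_derivative_aux n).2

/-- The Legendre differential equation. -/
theorem derivative_mul_derivative_legendreQ (n : ℕ) :
    derivative (X * (1 - X) * derivative (legendreQ n)) =
      -((n : ℝ[X]) * ((n : ℝ[X]) + 1)) * legendreQ n := by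
  rcases n with _ | n
  · simp [legendreQ]
  have hA := legendreQ_succ_derivative n
  have hB := legendreQ_derivative n
  have hs : (-4 * (X * (1 - X)) : ℝ[X]) ≠ 0 := by
    refine mul_ne_zero (by norm_num) (mul_ne_zero X_ne_zero ?_)
    intro h
    have := congrArg (eval 0) h
    simp at this
  have hd := congrArg derivative hA
  rw [mul_assoc (-2 : ℝ[X]), show (-2 : ℝ[X]) = C (-2) by simp [map_ofNat C 2], derivative_C_mul] at hd
  simp only [derivative_mul, derivative_sub, derivative_add, derivative_natCast, derivative_X,
      derivative_one, derivative_ofNat, map_neg, map_ofNat] at hd ⊢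
  -- After multiplication by -4X(1 - X), every remaining first derivative can be eliminated with the
  -- two first-order formulas.
  refine mul_left_cancel₀ hs ?_
  push_cast
  linear_combination 2 * (X * (1 - X)) * hd - ((n : ℝ[X]) + 1) * hB
    + ((n : ℝ[X]) + 1) * (1 - 2 * X) * hA

theorem eval_one_sub_legendreQ (n : ℕ) (t : ℝ) :
    (legendreQ n).eval (1 - t) = (-1) ^ n * (legendreQ n).eval t := by
  suffices h : (legendreQ n).eval (1 - t) = (-1) ^ n * (legendreQ n).eval t ∧
      (legendreQ (n + 1)).eval (1 - t) = (-1) ^ (n + 1) * (legendreQ (n + 1)).eval t from h.1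
  induction n with
  | zero => simp [legendreQ]; ring
  | succ n ih =>
    refine ⟨ih.2, ?_⟩
    simp only [legendreQ, eval_sub, eval_mul, eval_C, eval_one, eval_ofNat, eval_X, ih.1, ih.2]
    ring

/-- Integral of a polynomial over the unit interval. -/
theorem integral_eval_derivative (p : ℝ[X]) :
    ∫ t in (0 : ℝ)..1, (derivative p).eval t = p.eval 1 - p.eval 0 :=
  intervalIntegral.integral_eq_sub_of_hasDerivAt (fun t _ => p.hasDerivAt t)
    ((derivative p).continuous.intervalIntegrable _ _)

/-- Sturm–Liouville argument: the Wronskian of two eigenfunctions, weighted by t(1 - t), vanishes at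
both ends, and its derivative is the difference of eigenvalues times the product. -/
theorem integral_legendreQ_mul_of_ne {m n : ℕ} (h : m ≠ n) :
    ∫ t in (0 : ℝ)..1, (legendreQ m * legendreQ n).eval t = 0 := by
  have key : derivative (X * (1 - X) * derivative (legendreQ m) * legendreQ n
      - X * (1 - X) * derivative (legendreQ n) * legendreQ m) =
      C ((n : ℝ) * (n + 1) - m * (m + 1)) * (legendreQ m * legendreQ n) := by
    have hC : C ((n : ℝ) * (n + 1) - m * (m + 1)) =
      (n : ℝ[X]) * ((n : ℝ[X]) + 1) - (m : ℝ[X]) * ((m : ℝ[X]) + 1) := by simp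
    rw [derivative_sub, derivative_mul (g := legendreQ n), derivative_mul (g := legendreQ m),
      derivative_mul_derivative_legendreQ, derivative_mul_derivative_legendreQ, hC]
    ring
  have h1 := integral_eval_derivative (X * (1 - X) * derivative (legendreQ m) * legendreQ n
      - X * (1 - X) * derivative (legendreQ n) * legendreQ m)
  rw [key] at h1
  simp only [eval_mul, eval_C, eval_sub, eval_X, eval_one, sub_self, mul_zero, zero_mul,
    sub_zero, mul_one] at h1
  rw [intervalIntegral.integral_const_mul] at h1
  simp only [eval_mul]
  refine (mul_eq_zero.1 h1).resolve_left fun h2 => h ?_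
  have h3 : ((n : ℝ) - m) * (n + m + 1) = 0 := by linear_combination h2
  have h4 : ((n : ℝ) - m) = 0 := (mul_eq_zero.1 h3).resolve_right (by positivity)
  exact_mod_cast (sub_eq_zero.1 h4).symm

theorem integral_legendreQ_mul_self (n : ℕ) :
    ∫ t in (0 : ℝ)..1, (legendreQ n * legendreQ n).eval t = 1 / (2 * n + 1) := by
  have hint : ∀ p : ℝ[X], IntervalIntegrable (fun t => p.eval t) MeasureTheory.volume 0 1 :=
    fun p => p.continuous.intervalIntegrable _ _
  -- the recurrence tested against a polynomial
  have hrec : ∀ (n : ℕ) (p : ℝ[X]), ((n : ℝ) + 2) * ∫ t in (0 : ℝ)..1, (legendreQ (n + 2) * p).eval t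
      = (2 * n + 3) * (∫ t in (0 : ℝ)..1, ((1 - 2 * X) * legendreQ (n + 1) * p).eval t)
        - (n + 1) * ∫ t in (0 : ℝ)..1, (legendreQ n * p).eval t := by
    intro n p
    rw [← intervalIntegral.integral_const_mul, ← intervalIntegral.integral_const_mul,
      ← intervalIntegral.integral_const_mul, ← intervalIntegral.integral_sub
      ((hint _).const_mul _) ((hint _).const_mul _)]
    refine intervalIntegral.integral_congr fun t _ => ?_
    have := congrArg (eval t) (legendreQ_add_two n)
    simp only [eval_mul, eval_add, eval_sub, eval_natCast, eval_ofNat, eval_one, eval_X] at this ⊢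
    linear_combination (eval t p) * this
  induction n using Nat.strong_induction_on with
  | _ n ih =>
    rcases n with _ | _ | n
    · simp [legendreQ]
    · have h := integral_eval_derivative (X - 2 * X ^ 2 + C (4 / 3 : ℝ) * X ^ 3)
      have e : derivative (X - 2 * X ^ 2 + C (4 / 3 : ℝ) * X ^ 3) = legendreQ 1 * legendreQ 1 := by
        refine Polynomial.funext fun t => ?_
        simp [legendreQ, derivative_pow]
        ring
      rw [zero_add, ← e, h]
      norm_num
    -- The recurrence at n tested against Q_(n+2), and at n+1 tested against Q_(n+1), share the
    -- integral of (1 - 2t) Q_(n+1) Q_(n+2). Orthogonality removes one other term from each, so the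
    -- two norms become proportional.
    · have h1 := hrec n (legendreQ (n + 2))
      have h2 := hrec (n + 1) (legendreQ (n + 1))
      rw [integral_legendreQ_mul_of_ne (by omega), ih (n + 1) (by omega)] at h2
      rw [integral_legendreQ_mul_of_ne (m := n) (by omega)] at h1
      have e : ∫ t in (0 : ℝ)..1, ((1 - 2 * X) * legendreQ (n + 1) * legendreQ (n + 2)).eval t =
          ∫ t in (0 : ℝ)..1, ((1 - 2 * X) * legendreQ (n + 2) * legendreQ (n + 1)).eval t := by
        congr 1; ext t; simp only [eval_mul]; ring
      rw [e] at h1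
      push_cast at h1 h2 ⊢
      rw [add_assoc (n : ℝ) 1 1] at *
      set A := ∫ t in (0 : ℝ)..1, (legendreQ (n + 2) * legendreQ (n + 2)).eval t
      have h3 : ((n : ℝ) + 2) ≠ 0 := by positivity
      have h4 : (2 * ((n : ℝ) + 1) + 1) ≠ 0 := by positivity
      have h5 : (2 * ((n : ℝ) + 2) + 1) ≠ 0 := by positivity
      field_simp at h2 ⊢
      refine mul_left_cancel₀ h3 ?_
      linear_combination (2 * ((n : ℝ) + 2) + 1) * h1 - h2

/-- The recurrence, solved for X Q_n, shows that the span is stable under multiplication by X; it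
also contains 1. -/
theorem span_legendreQ : Submodule.span ℝ (Set.range legendreQ) = ⊤ := by
  set S := Submodule.span ℝ (Set.range legendreQ)
  have hmem : ∀ n, legendreQ n ∈ S := fun n => Submodule.subset_span ⟨n, rfl⟩
  have hX : ∀ p ∈ S, X * p ∈ S := by
    intro p hp
    induction hp using Submodule.span_induction with
    | mem p hp =>
      obtain ⟨n, rfl⟩ := hp
      rcases n with _ | n
      · have : X * legendreQ 0 = (1 / 2 : ℝ) • (legendreQ 0 - legendreQ 1) := by
          rw [smul_eq_C_mul]
          simp only [legendreQ]
          rw [show (1 - (1 - 2 * X) : ℝ[X]) = C 2 * X by simp [map_ofNat C 2], ← mul_assoc, ← C_mul]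
          norm_num
        rw [this]
        exact S.smul_mem _ (S.sub_mem (hmem _) (hmem _))
      · have : X * legendreQ (n + 1) = (1 / 2 : ℝ) • legendreQ (n + 1)
            - (((n : ℝ) + 2) / (2 * (2 * n + 3))) • legendreQ (n + 2)
            - (((n : ℝ) + 1) / (2 * (2 * n + 3))) • legendreQ n := by
          refine Polynomial.funext fun t => ?_
          have := congrArg (eval t) (legendreQ_add_two n)
          have h3 : (2 * (n : ℝ) + 3) ≠ 0 := by positivity
          simp only [eval_mul, eval_add, eval_sub, eval_natCast, eval_ofNat, eval_one, eval_X,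
            eval_smul, smul_eq_mul] at this ⊢
          field_simp
          linear_combination this
        rw [this]
        exact S.sub_mem (S.sub_mem (S.smul_mem _ (hmem _)) (S.smul_mem _ (hmem _)))
          (S.smul_mem _ (hmem _))
    | zero => simp
    | add p q _ _ hp hq => rw [mul_add]; exact S.add_mem hp hq
    | smul a p _ hp => rw [mul_smul_comm]; exact S.smul_mem _ hp
  refine eq_top_iff.2 fun p _ => ?_
  induction p using Polynomial.induction_on' with
  | add p q hp hq => exact S.add_mem (hp trivial) (hq trivial)
  | monomial n a =>
    rw [← C_mul_X_pow_eq_monomial, ← smul_eq_C_mul]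
    refine S.smul_mem _ ?_
    clear * - hmem hX
    induction n with
    | zero => simpa [legendreQ] using hmem 0
    | succ n ih => rw [pow_succ']; exact hX _ ih

end

/-- The shifted Legendre polynomials, normalised in `L²` of the unit interval. -/
def legendreLp (n : ℕ) : Lp ℝ 2 (volume : Measure unitInterval) :=
  ContinuousMap.toLp 2 volume ℝ
    (Polynomial.toContinuousMapOnAlgHom unitInterval ((√(2 * n + 1)) • legendreQ n))

theorem integral_unitInterval (f : ℝ → ℝ) :
    ∫ x : unitInterval, f x = ∫ t in (0 : ℝ)..1, f t := by
  rw [intervalIntegral.integral_of_le zero_le_one, ← integral_Icc_eq_integral_Ioc]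
  exact integral_subtype measurableSet_Icc f

theorem orthonormal_legendreLp : Orthonormal ℝ legendreLp := by
  rw [orthonormal_iff_ite]
  intro i j
  rw [legendreLp, legendreLp, ContinuousMap.inner_toLp]
  have h := integral_unitInterval
    fun t => √(2 * j + 1) * √(2 * i + 1) * (legendreQ i * legendreQ j).eval t
  rw [intervalIntegral.integral_const_mul] at h
  refine Eq.trans (integral_congr_ae (.of_forall fun x => ?_)) (h.trans ?_)
  · simp
    ring
  · split_ifs with hij
    · subst hij
      rw [integral_legendreQ_mul_self, Real.mul_self_sqrt (by positivity)]
      field_simp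
    · rw [integral_legendreQ_mul_of_ne hij, mul_zero]

/-- Weierstrass approximation plus density of continuous functions in L². -/
theorem span_legendreLp :
    ⊤ ≤ (Submodule.span ℝ (Set.range legendreLp)).topologicalClosure := by
  have h1 : (polynomialFunctions unitInterval).toSubmodule.topologicalClosure = ⊤ := by
    have := polynomialFunctions_closure_eq_top'
    rw [SetLike.ext'_iff] at this ⊢
    simpa using! this
  have h2 := (ContinuousMap.toLp_denseRange ℝ (volume : Measure unitInterval) ℝ
    (p := 2) (by simp)).topologicalClosure_map_submodule h1
  rw [← h2]
  refine Submodule.topologicalClosure_mono ?_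
  rintro _ ⟨_, ⟨p, -, rfl⟩, rfl⟩
  let Λ : Polynomial ℝ →ₗ[ℝ] Lp ℝ 2 (volume : Measure unitInterval) :=
    (ContinuousMap.toLp 2 (volume : Measure unitInterval) ℝ : C(unitInterval, ℝ) →L[ℝ] _).toLinearMap
      ∘ₗ (Polynomial.toContinuousMapOnAlgHom unitInterval).toLinearMap
  have hΛ : ∀ n : ℕ, Λ (√(2 * n + 1) • legendreQ n) = legendreLp n := fun n => rfl
  change Λ p ∈ _
  have hp : p ∈ Submodule.span ℝ (Set.range legendreQ) := by rw [span_legendreQ]; trivial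
  induction hp using Submodule.span_induction with
  | mem p hp =>
    obtain ⟨n, rfl⟩ := hp
    have : legendreQ n = (√(2 * n + 1))⁻¹ • (√(2 * n + 1)) • legendreQ n := by
      rw [smul_smul, inv_mul_cancel₀ (by positivity), one_smul]
    rw [this, map_smul, hΛ]
    exact Submodule.smul_mem _ _ (Submodule.subset_span ⟨n, rfl⟩)
  | zero => rw [map_zero]; exact Submodule.zero_mem _
  | add p q _ _ hp hq => rw [map_add]; exact Submodule.add_mem _ hp hq
  | smul a p _ hp => rw [map_smul]; exact Submodule.smul_mem _ a hp

/-- Parseval's identity for the shifted Legendre polynomials. -/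
theorem hasSum_sq_integral_mul_legendreQ {f : ℝ → ℝ}
    (hf : MemLp f 2 (volume.restrict (Icc 0 1))) :
    HasSum (fun n : ℕ => (2 * n + 1) * (∫ t in (0 : ℝ)..1, f t * (legendreQ n).eval t) ^ 2)
      (∫ t in (0 : ℝ)..1, f t ^ 2) := by
  have hf' : MemLp (fun x : unitInterval => f x) 2 volume :=
    hf.comp_measurePreserving (measurePreserving_subtype_coe measurableSet_Icc)
  have hb := (HilbertBasis.mk orthonormal_legendreLp span_legendreLp).hasSum_inner_mul_inner
    (hf'.toLp _) (hf'.toLp _)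
  rw [HilbertBasis.coe_mk] at hb
  have hae := hf'.coeFn_toLp
  have e1 : inner ℝ (hf'.toLp _) (hf'.toLp _) = ∫ t in (0 : ℝ)..1, f t ^ 2 := by
    rw [MeasureTheory.L2.inner_def, ← integral_unitInterval]
    refine integral_congr_ae ?_
    filter_upwards [hae] with x hx
    rw [hx]
    simp [sq]
  have e2 : ∀ n : ℕ, inner ℝ (hf'.toLp _) (legendreLp n) =
      √(2 * n + 1) * ∫ t in (0 : ℝ)..1, f t * (legendreQ n).eval t := by
    intro n
    rw [MeasureTheory.L2.inner_def, ← intervalIntegral.integral_const_mul, ← integral_unitInterval]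
    refine integral_congr_ae ?_
    have hae2 := ContinuousMap.coeFn_toLp (p := 2) (𝕜 := ℝ) (volume : Measure unitInterval)
      (Polynomial.toContinuousMapOnAlgHom unitInterval ((√(2 * n + 1)) • legendreQ n))
    filter_upwards [hae, hae2] with x hx hx2
    rw [hx, legendreLp, hx2]
    simp
    ring
  rw [e1] at hb
  convert! hb using 2 with n
  rw [real_inner_comm _ (legendreLp n), e2]
  rw [mul_mul_mul_comm, Real.mul_self_sqrt (by positivity), sq]

/-! ### The product `F(t) F(1 - t)` and its Legendre coefficients -/

/-- The product `F(t) F(1 - t)`. -/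
def ellW (t : ℝ) : ℝ := ellF t * ellF (1 - t)

theorem abs_lt_one_of_mem_Ioo {t : ℝ} (ht : t ∈ Ioo (0 : ℝ) 1) : |t| < 1 := by
  rw [abs_of_pos ht.1]; exact ht.2

theorem one_sub_mem_Ioo {t : ℝ} (ht : t ∈ Ioo (0 : ℝ) 1) : 1 - t ∈ Ioo (0 : ℝ) 1 :=
  ⟨by linarith [ht.2], by linarith [ht.1]⟩

theorem hasDerivAt_ellF_one_sub {t : ℝ} (ht : t ∈ Ioo (0 : ℝ) 1) :
    HasDerivAt (fun t => ellF (1 - t)) (-(ellG (1 - t) / t)) t := by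
  have h := (hasDerivAt_ellF (abs_lt_one_of_mem_Ioo (one_sub_mem_Ioo ht))).comp t
    ((hasDerivAt_id t).const_sub 1)
  refine h.congr_deriv ?_
  simp

theorem hasDerivAt_one_sub_mul_ellG {t : ℝ} (ht : t ∈ Ioo (0 : ℝ) 1) :
    HasDerivAt (fun t => (1 - t) * ellG (1 - t)) (-(ellF (1 - t) / 4)) t := by
  have h := (hasDerivAt_mul_ellG (abs_lt_one_of_mem_Ioo (one_sub_mem_Ioo ht))).comp t
    ((hasDerivAt_id t).const_sub 1)
  refine h.congr_deriv ?_
  simp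

theorem continuousOn_ellF : ContinuousOn ellF (Ico 0 1) := fun t ht =>
  (hasDerivAt_ellF (by rw [abs_of_nonneg ht.1]; exact ht.2)).continuousAt.continuousWithinAt

theorem continuousOn_ellF_one_sub : ContinuousOn (fun t => ellF (1 - t)) (Ioo 0 1) := fun _ ht =>
  (hasDerivAt_ellF_one_sub ht).continuousAt.continuousWithinAt

theorem continuousOn_ellW : ContinuousOn ellW (Ioo 0 1) :=
  (continuousOn_ellF.mono Ioo_subset_Ico_self).mul continuousOn_ellF_one_sub

theorem tendsto_ellF_zero : Tendsto ellF (𝓝[>] 0) (𝓝 1) := by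
  have h := (hasDerivAt_ellF (t := 0) (by simp)).continuousAt.tendsto
  rw [ellF_zero] at h
  exact h.mono_left nhdsWithin_le_nhds

theorem tendsto_ellG_zero : Tendsto ellG (𝓝[>] 0) (𝓝 (ellG 0)) :=
  ((continuousOn_ellG 0 (by simp)).mono_of_mem_nhdsWithin
    (mem_of_superset (Ioo_mem_nhdsGT one_pos) Ioo_subset_Icc_self)).tendsto

theorem tendsto_one_sub_nhdsGT_zero : Tendsto (fun t : ℝ => 1 - t) (𝓝[>] 0) (𝓝[<] 1) := by
  refine tendsto_nhdsWithin_iff.2 ⟨?_, ?_⟩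
  · have : Tendsto (fun t : ℝ => 1 - t) (𝓝 0) (𝓝 (1 - 0)) := by
      exact (continuous_const.sub continuous_id).tendsto 0
    rw [sub_zero] at this
    exact this.mono_left nhdsWithin_le_nhds
  · filter_upwards [self_mem_nhdsWithin] with t ht
    have : (0 : ℝ) < t := ht
    exact sub_lt_self 1 this

theorem tendsto_one_sub_nhdsLT_one : Tendsto (fun t : ℝ => 1 - t) (𝓝[<] 1) (𝓝[>] 0) := by
  refine tendsto_nhdsWithin_iff.2 ⟨?_, ?_⟩
  · have : Tendsto (fun t : ℝ => 1 - t) (𝓝 1) (𝓝 (1 - 1)) := by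
      exact (continuous_const.sub continuous_id).tendsto 1
    rw [sub_self] at this
    exact this.mono_left nhdsWithin_le_nhds
  · filter_upwards [self_mem_nhdsWithin] with t ht
    have : t < (1 : ℝ) := ht
    exact sub_pos.2 this

theorem tendsto_ellG_one_sub : Tendsto (fun t => ellG (1 - t)) (𝓝[>] 0) (𝓝 (1 / π)) := by
  have h : Tendsto ellG (𝓝[<] 1) (𝓝 (ellG 1)) :=
    ((continuousOn_ellG 1 (by simp)).mono_of_mem_nhdsWithin
      (mem_of_superset (Ioo_mem_nhdsLT one_pos) Ioo_subset_Icc_self)).tendsto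
  rw [ellG_one] at h
  exact h.comp tendsto_one_sub_nhdsGT_zero

theorem tendsto_mul_ellF_one_sub : Tendsto (fun t => t * ellF (1 - t)) (𝓝[>] 0) (𝓝 0) := by
  have h : Tendsto (fun t : ℝ => 8 * t ^ (7 / 8 : ℝ)) (𝓝[>] 0) (𝓝 0) := by
    have : Tendsto (fun t : ℝ => 8 * t ^ (7 / 8 : ℝ)) (𝓝 0) (𝓝 (8 * 0 ^ (7 / 8 : ℝ))) :=
      ((Real.continuous_rpow_const (by norm_num)).const_mul 8).tendsto 0
    rw [Real.zero_rpow (by norm_num), mul_zero] at this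
    exact this.mono_left nhdsWithin_le_nhds
  refine squeeze_zero' ?_ ?_ h
  · filter_upwards [Ioo_mem_nhdsGT (zero_lt_one' ℝ)] with t ht
    exact mul_nonneg ht.1.le (ellF_pos (one_sub_mem_Ioo ht).1.le (one_sub_mem_Ioo ht).2).le
  · filter_upwards [Ioo_mem_nhdsGT (zero_lt_one' ℝ)] with t ht
    have h1 := ellF_le_rpow (one_sub_mem_Ioo ht).1.le (one_sub_mem_Ioo ht).2
    rw [sub_sub_cancel] at h1
    calc t * ellF (1 - t) ≤ t * (8 * t ^ (-(1 / 8) : ℝ)) := by gcongr; exact ht.1.le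
      _ = 8 * (t ^ (1 : ℝ) * t ^ (-(1 / 8) : ℝ)) := by rw [Real.rpow_one]; ring
      _ = 8 * t ^ (7 / 8 : ℝ) := by rw [← Real.rpow_add ht.1]; norm_num

theorem intervalIntegrable_ellF_one_sub :
    IntervalIntegrable (fun t => ellF (1 - t)) volume 0 1 := by
  rw [intervalIntegrable_iff_integrableOn_Ioo_of_le zero_le_one]
  have h : IntegrableOn (fun t : ℝ => 8 * t ^ (-(1 / 8) : ℝ)) (Ioo 0 1) := by
    rw [← intervalIntegrable_iff_integrableOn_Ioo_of_le zero_le_one]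
    exact (intervalIntegral.intervalIntegrable_rpow' (by norm_num)).const_mul 8
  refine h.mono' (continuousOn_ellF_one_sub.aestronglyMeasurable measurableSet_Ioo) ?_
  filter_upwards [ae_restrict_mem measurableSet_Ioo] with t ht
  have ht' := one_sub_mem_Ioo ht
  have h1 := ellF_le_rpow ht'.1.le ht'.2
  rw [sub_sub_cancel] at h1
  rwa [Real.norm_of_nonneg (ellF_pos ht'.1.le ht'.2).le]

theorem memLp_ellW : MemLp ellW 2 (volume.restrict (Icc 0 1)) := by
  rw [← restrict_Ioo_eq_restrict_Icc]
  have hm := continuousOn_ellW.aestronglyMeasurable (μ := volume) measurableSet_Ioo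
  rw [memLp_two_iff_integrable_sq hm]
  have h : IntegrableOn (fun t : ℝ => 2048 * (t ^ (-(1 / 2) : ℝ) + (1 - t) ^ (-(1 / 2) : ℝ)))
      (Ioo 0 1) := by
    rw [← intervalIntegrable_iff_integrableOn_Ioo_of_le zero_le_one]
    have h1 : IntervalIntegrable (fun t : ℝ => t ^ (-(1 / 2) : ℝ)) volume 0 1 :=
      intervalIntegral.intervalIntegrable_rpow' (by norm_num)
    have h2 := (h1.comp_sub_left 1).symm
    rw [sub_zero, sub_self] at h2
    exact (h1.add h2).const_mul _
  refine h.mono' (hm.pow 2) ?_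
  filter_upwards [ae_restrict_mem measurableSet_Ioo] with t ht
  have ht' := one_sub_mem_Ioo ht
  have h1 := ellF_le_rpow ht'.1.le ht'.2
  have h2 := ellF_le_rpow ht.1.le ht.2
  have p1 := ellF_pos ht'.1.le ht'.2
  have p2 := ellF_pos ht.1.le ht.2
  rw [sub_sub_cancel] at h1
  rw [Real.norm_of_nonneg (by positivity)]
  set a := t ^ (-(1 / 8) : ℝ) with ha
  set b := (1 - t) ^ (-(1 / 8) : ℝ) with hb
  have ha4 : t ^ (-(1 / 2) : ℝ) = a ^ 4 := by
    rw [ha, ← Real.rpow_natCast, ← Real.rpow_mul ht.1.le]; norm_num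
  have hb4 : (1 - t) ^ (-(1 / 2) : ℝ) = b ^ 4 := by
    rw [hb, ← Real.rpow_natCast, ← Real.rpow_mul ht'.1.le]; norm_num
  rw [ha4, hb4]
  have hw : ellW t ≤ 64 * (a * b) := by
    calc ellF t * ellF (1 - t) ≤ (8 * b) * (8 * a) := mul_le_mul h2 h1 p1.le (p2.le.trans h2)
      _ = _ := by ring
  have hw0 : 0 ≤ ellW t := (mul_pos p2 p1).le
  calc ellW t ^ 2 ≤ (64 * (a * b)) ^ 2 := by gcongr
    -- AM-GM for a⁴ and b⁴; 2048 is 64²/2.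
    _ ≤ 2048 * (a ^ 4 + b ^ 4) := by nlinarith [sq_nonneg (a ^ 2 - b ^ 2)]

theorem intervalIntegrable_ellW : IntervalIntegrable ellW volume 0 1 := by
  rw [intervalIntegrable_iff_integrableOn_Icc_of_le zero_le_one]
  exact memLp_ellW.integrable (by norm_num)

theorem intervalIntegrable_ellW_mul (p : Polynomial ℝ) :
    IntervalIntegrable (fun t => ellW t * p.eval t) volume 0 1 :=
  intervalIntegrable_ellW.mul_continuousOn p.continuous.continuousOn

/-- An auxiliary expression: `(t (1 - t) d/dt)² (F(t) F(1 - t))`. -/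
def ellB (t : ℝ) : ℝ :=
  t * (1 - t) * ellW t / 2 - 2 * (t * ellG t) * ((1 - t) * ellG (1 - t))

/-- An auxiliary expression: `t (1 - t) d/dt (F(t) F(1 - t))`. -/
def ellD (t : ℝ) : ℝ := t * ellG t * ellF (1 - t) - ellF t * ((1 - t) * ellG (1 - t))

theorem ellW_one_sub (t : ℝ) : ellW (1 - t) = ellW t := by
  simp only [ellW, sub_sub_cancel]; ring

theorem ellB_one_sub (t : ℝ) : ellB (1 - t) = ellB t := by
  simp only [ellB, ellW, sub_sub_cancel]; ring

theorem ellD_one_sub (t : ℝ) : ellD (1 - t) = -ellD t := by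
  simp only [ellD, sub_sub_cancel]; ring

theorem hasDerivAt_ellW {t : ℝ} (ht : t ∈ Ioo (0 : ℝ) 1) :
    HasDerivAt ellW (ellD t / (t * (1 - t))) t := by
  have h := (hasDerivAt_ellF (abs_lt_one_of_mem_Ioo ht)).mul (hasDerivAt_ellF_one_sub ht)
  refine h.congr_deriv ?_
  have h0 : t ≠ 0 := ht.1.ne'
  have h1 : 1 - t ≠ 0 := (one_sub_mem_Ioo ht).1.ne'
  unfold ellD
  field_simp
  ring

theorem hasDerivAt_ellD {t : ℝ} (ht : t ∈ Ioo (0 : ℝ) 1) :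
    HasDerivAt ellD (ellB t / (t * (1 - t))) t := by
  have h := ((hasDerivAt_mul_ellG (abs_lt_one_of_mem_Ioo ht)).mul (hasDerivAt_ellF_one_sub ht)).sub
    ((hasDerivAt_ellF (abs_lt_one_of_mem_Ioo ht)).mul (hasDerivAt_one_sub_mul_ellG ht))
  refine h.congr_deriv ?_
  have h0 : t ≠ 0 := ht.1.ne'
  have h1 : 1 - t ≠ 0 := (one_sub_mem_Ioo ht).1.ne'
  simp only [ellB, ellW]
  field_simp
  ring

/-- Closes the system: W, D, B satisfy a linear first-order system with rational coefficients, the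
symmetric square of the hypergeometric equation. -/
theorem hasDerivAt_ellB {t : ℝ} (ht : t ∈ Ioo (0 : ℝ) 1) :
    HasDerivAt ellB (ellD t + (1 - 2 * t) / 2 * ellW t) t := by
  have hs : HasDerivAt (fun t : ℝ => t * (1 - t)) (1 - 2 * t) t :=
    ((hasDerivAt_id t).mul ((hasDerivAt_id t).const_sub 1)).congr_deriv (by simp; ring)
  have h := ((hs.mul (hasDerivAt_ellW ht)).div_const 2).sub
    (((hasDerivAt_mul_ellG (abs_lt_one_of_mem_Ioo ht)).const_mul 2).mul
      (hasDerivAt_one_sub_mul_ellG ht))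
  refine h.congr_deriv ?_
  have h0 : t ≠ 0 := ht.1.ne'
  have h1 : 1 - t ≠ 0 := (one_sub_mem_Ioo ht).1.ne'
  simp only [ellD, ellW]
  field_simp
  ring

/-- Vanishing of the boundary terms in the integration by parts below. D tends to the nonzero limit
-1/π, so its factor t(1 - t) is essential; the endpoint 1 is reduced to 0 by symmetry. -/
theorem tendsto_ellB_combination {q r : ℝ → ℝ} (hq : Continuous q) (hr : Continuous r) (N : ℝ) :
    Tendsto (fun t => q t * ellB t - t * (1 - t) * r t * ellD t - N * q t * (t * (1 - t) * ellW t))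
      (𝓝[>] 0) (𝓝 0) := by
  have ht : Tendsto (fun t : ℝ => t) (𝓝[>] 0) (𝓝 0) := nhdsWithin_le_nhds
  have ht1 : Tendsto (fun t : ℝ => 1 - t) (𝓝[>] 0) (𝓝 (1 - 0)) := tendsto_const_nhds.sub ht
  have hq' := (hq.tendsto 0).mono_left (nhdsWithin_le_nhds (s := Ioi 0))
  have hr' := (hr.tendsto 0).mono_left (nhdsWithin_le_nhds (s := Ioi 0))
  have hv := tendsto_mul_ellF_one_sub
  have hs : Tendsto (fun t => t * (1 - t) * ellW t) (𝓝[>] 0) (𝓝 0) := by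
    have := (ht1.mul tendsto_ellF_zero).mul hv
    rw [mul_zero] at this
    exact this.congr fun t => by simp only [ellW]; ring
  have hV := ht1.mul tendsto_ellG_one_sub
  have hU := ht.mul tendsto_ellG_zero
  have hB : Tendsto ellB (𝓝[>] 0) (𝓝 0) := by
    have := (hs.div_const 2).sub ((hU.const_mul 2).mul hV)
    simp only [zero_mul, mul_zero, zero_div, sub_zero] at this
    exact this
  have hD : Tendsto ellD (𝓝[>] 0) (𝓝 (-(1 / π))) := by
    have := (tendsto_ellG_zero.mul hv).sub (tendsto_ellF_zero.mul hV)
    simp only [mul_zero, sub_zero, one_mul, zero_sub] at this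
    exact this.congr fun t => by simp only [ellD]; ring
  have := ((hq'.mul hB).sub (((ht.mul ht1).mul hr').mul hD)).sub ((hq'.const_mul N).mul hs)
  simpa using this

/-- The three-term relation for the Legendre coefficients of `F(t) F(1 - t)`. -/
theorem integral_ellW_mul_legendreQ_rec (n : ℕ) :
    ((n : ℝ) + 2) ^ 4 * (∫ t in (0 : ℝ)..1, ellW t * (legendreQ (n + 2)).eval t) =
      ((n : ℝ) + 1) ^ 4 * ∫ t in (0 : ℝ)..1, ellW t * (legendreQ n).eval t := by
  set m : ℝ := n + 1 with hm
  set N : ℝ := m * (m + 1) + 1 with hN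
  set Q := legendreQ (n + 1)
  -- Lagrange's bilinear concomitant of the third-order equation with Q. In H' the terms in B
  -- cancel, and N = m(m+1) + 1 is the value that cancels those in D. What remains is W times a
  -- combination of Q' and (1 - 2t)Q, hence of Q_n and Q_(n+2); the fourth powers arise from N(m+2)
  -- - 1 = (m+1)³ and N(2m+1) - (m+1)³ = m³.
  set H : ℝ → ℝ := fun t => Q.eval t * ellB t - t * (1 - t) * (Polynomial.derivative Q).eval t *
    ellD t - N * Q.eval t * (t * (1 - t) * ellW t) with hH
  have hderiv : ∀ t ∈ Ioo (0 : ℝ) 1, HasDerivAt H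
      (-(1 / (2 * (2 * m + 1))) * ((n + 2) ^ 4 * (ellW t * (legendreQ (n + 2)).eval t)
        - (n + 1) ^ 4 * (ellW t * (legendreQ n).eval t))) t := by
    intro t ht
    have hs : HasDerivAt (fun t : ℝ => t * (1 - t)) (1 - 2 * t) t :=
      ((hasDerivAt_id t).mul ((hasDerivAt_id t).const_sub 1)).congr_deriv (by simp; ring)
    have hsQ := (Polynomial.X * (1 - Polynomial.X) * Polynomial.derivative Q).hasDerivAt t
    rw [derivative_mul_derivative_legendreQ] at hsQ
    simp only [Polynomial.eval_mul, Polynomial.eval_X, Polynomial.eval_sub, Polynomial.eval_one,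
      Polynomial.eval_neg, Polynomial.eval_add, Polynomial.eval_natCast] at hsQ
    have h := (((Q.hasDerivAt t).mul (hasDerivAt_ellB ht)).sub (hsQ.mul (hasDerivAt_ellD ht))).sub
      (((Q.hasDerivAt t).const_mul N).mul (hs.mul (hasDerivAt_ellW ht)))
    refine h.congr_deriv ?_
    have h0 : t ≠ 0 := ht.1.ne'
    have h1 : 1 - t ≠ 0 := (one_sub_mem_Ioo ht).1.ne'
    have hr := congrArg (Polynomial.eval t) (legendreQ_add_two n)
    have hd := congrArg (Polynomial.eval t) (legendreQ_succ_derivative n)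
    simp only [Polynomial.eval_mul, Polynomial.eval_X, Polynomial.eval_sub, Polynomial.eval_one,
      Polynomial.eval_neg, Polynomial.eval_add, Polynomial.eval_natCast,
      Polynomial.eval_ofNat] at hr hd
    have hm1 : 2 * m + 1 ≠ 0 := by positivity
    have e1 : ((n + 1 : ℕ) : ℝ) = m := by simp [hm]
    have e2 : (n : ℝ) = m - 1 := by simp [hm]
    rw [e1]
    rw [e2] at hr hd ⊢
    change _ * Polynomial.eval t (Polynomial.derivative Q) = _ * (_ - _ * Polynomial.eval t Q) at hd
    change _ = _ * Polynomial.eval t Q - _ at hr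
    change _ + _ - (_ * Polynomial.eval t Q * _ + _) - _ = _
    set q := Polynomial.eval t Q
    set q' := Polynomial.eval t (Polynomial.derivative Q)
    set q2 := Polynomial.eval t (legendreQ (n + 2))
    set q0 := Polynomial.eval t (legendreQ n)
    have eB : t * (1 - t) * q' * (ellB t / (t * (1 - t))) = q' * ellB t := by field_simp
    have eD : t * (1 - t) * (ellD t / (t * (1 - t))) = ellD t := by field_simp
    obtain ⟨k, hk⟩ : ∃ k : ℝ, k = 1 / (2 * (2 * m + 1)) := ⟨_, rfl⟩
    have hk' : k * (2 * (2 * m + 1)) = 1 := by rw [hk]; field_simp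
    rw [← hk, Pi.mul_apply]
    linear_combination (-1 : ℝ) * eB - N * q * eD + ellW t * N / 2 * hd
      + ellW t * (m + 1) ^ 3 * k * hr
      - (ellW t * N / 2 * m * (q0 - (1 - 2 * t) * q) - (N - 1 / 2) * (1 - 2 * t) * q * ellW t) * hk'
      - (ellD t * q + 0) * hN
  have hint : IntervalIntegrable (fun t => -(1 / (2 * (2 * m + 1))) *
      ((n + 2) ^ 4 * (ellW t * (legendreQ (n + 2)).eval t)
        - (n + 1) ^ 4 * (ellW t * (legendreQ n).eval t))) volume 0 1 :=
    (((intervalIntegrable_ellW_mul _).const_mul _).sub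
      ((intervalIntegrable_ellW_mul _).const_mul _)).const_mul _
  have h0 : Tendsto H (𝓝[>] 0) (𝓝 0) :=
    tendsto_ellB_combination Q.continuous (Polynomial.derivative Q).continuous N
  have h1 : Tendsto H (𝓝[<] 1) (𝓝 0) := by
    have := (tendsto_ellB_combination (q := fun t => Q.eval (1 - t))
      (r := fun t => -(Polynomial.derivative Q).eval (1 - t))
      (Q.continuous.comp (continuous_const.sub continuous_id))
      ((Polynomial.derivative Q).continuous.comp (continuous_const.sub continuous_id)).neg N).comp
      tendsto_one_sub_nhdsLT_one
    refine this.congr fun t => ?_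
    simp only [Function.comp, sub_sub_cancel, ellB_one_sub, ellD_one_sub, ellW_one_sub, hH]
    ring
  have h := intervalIntegral.integral_eq_sub_of_hasDerivAt_of_tendsto zero_lt_one hderiv hint h0 h1
  rw [intervalIntegral.integral_const_mul, sub_zero] at h
  have h2 := (mul_eq_zero.1 h).resolve_left (by
    have : 2 * m + 1 ≠ 0 := by positivity
    simp [this])
  rw [intervalIntegral.integral_sub ((intervalIntegrable_ellW_mul _).const_mul _)
      ((intervalIntegrable_ellW_mul _).const_mul _), intervalIntegral.integral_const_mul,
      intervalIntegral.integral_const_mul] at h2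
  linarith

theorem integral_ellW_mul_legendreQ_odd (n : ℕ) :
    ∫ t in (0 : ℝ)..1, ellW t * (legendreQ (2 * n + 1)).eval t = 0 := by
  have h := intervalIntegral.integral_comp_sub_left
    (fun t => ellW t * (legendreQ (2 * n + 1)).eval t) (a := 0) (b := 1) 1
  simp only [ellW_one_sub, eval_one_sub_legendreQ, sub_zero, sub_self] at h
  rw [pow_succ, pow_mul, neg_one_sq, one_pow] at h
  simp only [one_mul, neg_mul, mul_neg, intervalIntegral.integral_neg] at h
  linarith

/-- The ratio (2n+1)/(2n+2) of the recurrence is exactly a_(n+1)/a_n. -/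
theorem integral_ellW_mul_legendreQ_even (n : ℕ) :
    ∫ t in (0 : ℝ)..1, ellW t * (legendreQ (2 * n)).eval t =
      halfCoeff n ^ 4 * ∫ t in (0 : ℝ)..1, ellW t := by
  induction n with
  | zero => simp [legendreQ, halfCoeff_zero]
  | succ n ih =>
    have h := integral_ellW_mul_legendreQ_rec (2 * n)
    rw [ih] at h
    have h2 : ((2 * n : ℕ) : ℝ) + 2 ≠ 0 := by positivity
    refine mul_left_cancel₀ (pow_ne_zero 4 h2) ?_
    rw [show 2 * (n + 1) = 2 * n + 2 by ring, h, halfCoeff_succ]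
    push_cast
    field_simp

/-! ### Moments of F(1 - t) and the integral of W. -/

theorem integral_pow_mul_ellF_one_sub_rec (n : ℕ) :
    ((n : ℝ) + 3 / 2) ^ 2 * (∫ t in (0 : ℝ)..1, t ^ (n + 1) * ellF (1 - t)) =
      ((n : ℝ) + 1) ^ 2 * ∫ t in (0 : ℝ)..1, t ^ n * ellF (1 - t) := by
  have hI : ∀ k : ℕ, IntervalIntegrable (fun t => t ^ k * ellF (1 - t)) volume 0 1 := fun k =>
    intervalIntegrable_ellF_one_sub.continuousOn_mul (continuous_pow k).continuousOn
  -- Boundary expression from moving the hypergeometric operator from F(1 - t) onto a power of t; it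
  -- vanishes at both ends.
  have hderiv : ∀ t ∈ Ioo (0 : ℝ) 1, HasDerivAt
      (fun t => -(t ^ (n + 1) * ((1 - t) * ellG (1 - t))) -
        (n + 1) * (t ^ (n + 1) * (1 - t) * ellF (1 - t)))
      ((n + 3 / 2) ^ 2 * (t ^ (n + 1) * ellF (1 - t)) - (n + 1) ^ 2 * (t ^ n * ellF (1 - t))) t := by
    intro t ht
    have h := (((hasDerivAt_pow (n + 1) t).mul (hasDerivAt_one_sub_mul_ellG ht)).neg).sub
      ((((hasDerivAt_pow (n + 1) t).mul ((hasDerivAt_id t).const_sub 1)).mul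
        (hasDerivAt_ellF_one_sub ht)).const_mul ((n : ℝ) + 1))
    refine h.congr_deriv ?_
    have h0 : t ≠ 0 := ht.1.ne'
    simp only [Nat.add_sub_cancel, pow_succ, id, Pi.mul_apply]
    push_cast
    field_simp
    ring
  have ht : Tendsto (fun t : ℝ => t) (𝓝[>] 0) (𝓝 0) := nhdsWithin_le_nhds
  have ht1 : Tendsto (fun t : ℝ => 1 - t) (𝓝[>] 0) (𝓝 (1 - 0)) := tendsto_const_nhds.sub ht
  have h0 := ((ht.pow (n + 1)).mul (ht1.mul tendsto_ellG_one_sub)).neg.sub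
    ((((ht.pow n).mul ht1).mul tendsto_mul_ellF_one_sub).const_mul ((n : ℝ) + 1))
  have h1 := (((ht1.pow (n + 1)).mul (ht.mul tendsto_ellG_zero)).neg.sub
    ((((ht1.pow (n + 1)).mul ht).mul tendsto_ellF_zero).const_mul ((n : ℝ) + 1))).comp
    tendsto_one_sub_nhdsLT_one
  simp only [ne_eq, Nat.add_eq_zero_iff, one_ne_zero, and_false, not_false_eq_true, zero_pow,
    zero_mul, mul_zero, neg_zero, sub_zero] at h0 h1
  have h := intervalIntegral.integral_eq_sub_of_hasDerivAt_of_tendsto zero_lt_one hderiv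
    (((hI _).const_mul _).sub ((hI _).const_mul _)) (h0.congr fun t => by ring)
    (h1.congr fun t => by simp only [Function.comp, sub_sub_cancel])
  rw [intervalIntegral.integral_sub ((hI _).const_mul _) ((hI _).const_mul _),
    intervalIntegral.integral_const_mul, intervalIntegral.integral_const_mul] at h
  linarith

theorem integral_ellF_one_sub : ∫ t in (0 : ℝ)..1, ellF (1 - t) = 4 / π := by
  have hderiv : ∀ t ∈ Ioo (0 : ℝ) 1, HasDerivAt (fun t => -4 * ((1 - t) * ellG (1 - t)))
      (ellF (1 - t)) t := fun t ht =>
    ((hasDerivAt_one_sub_mul_ellG ht).const_mul (-4)).congr_deriv (by ring)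
  have ht : Tendsto (fun t : ℝ => t) (𝓝[>] 0) (𝓝 0) := nhdsWithin_le_nhds
  have ht1 : Tendsto (fun t : ℝ => 1 - t) (𝓝[>] 0) (𝓝 (1 - 0)) := tendsto_const_nhds.sub ht
  have h0 := (ht1.mul tendsto_ellG_one_sub).const_mul (-4)
  have h1 := ((ht.mul tendsto_ellG_zero).const_mul (-4)).comp tendsto_one_sub_nhdsLT_one
  rw [intervalIntegral.integral_eq_sub_of_hasDerivAt_of_tendsto zero_lt_one hderiv
    intervalIntegrable_ellF_one_sub h0 h1]
  ring

/-- The moment ratio ((n+1)/(n+3/2))² times (a_(n+1)/a_n)² is ((n+1/2)/(n+3/2))², which telescopes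
from the zeroth moment 4/π. -/
theorem halfCoeff_sq_mul_integral (n : ℕ) :
    halfCoeff n ^ 2 * (∫ t in (0 : ℝ)..1, t ^ n * ellF (1 - t)) =
      4 / π * (1 / (2 * n + 1) ^ 2) := by
  induction n with
  | zero =>
    simp only [halfCoeff_zero, pow_zero, one_mul, integral_ellF_one_sub]
    simp
  | succ n ih =>
    have h := integral_pow_mul_ellF_one_sub_rec n
    have h3 : (n : ℝ) + 3 / 2 ≠ 0 := by positivity
    refine mul_left_cancel₀ (pow_ne_zero 2 h3) ?_
    rw [mul_left_comm, h, halfCoeff_succ]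
    have : ((n + 1 / 2) / (n + 1) * halfCoeff n) ^ 2 *
        ((n + 1) ^ 2 * ∫ t in (0 : ℝ)..1, t ^ n * ellF (1 - t)) =
        (n + 1 / 2) ^ 2 * (halfCoeff n ^ 2 * ∫ t in (0 : ℝ)..1, t ^ n * ellF (1 - t)) := by
      field_simp
    rw [this, ih]
    push_cast
    have h4 : (2 * ((n : ℝ) + 1) + 1) ≠ 0 := by positivity
    field_simp
    ring

theorem hasSum_one_div_odd_sq : HasSum (fun n : ℕ => 1 / (2 * (n : ℝ) + 1) ^ 2) (π ^ 2 / 8) := by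
  obtain ⟨f, hf⟩ : ∃ f : ℕ → ℝ, f = fun n : ℕ => 1 / (n : ℝ) ^ 2 := ⟨_, rfl⟩
  have h : HasSum f (π ^ 2 / 6) := hf ▸ hasSum_zeta_two
  have he : HasSum (fun n : ℕ => f (2 * n)) (1 / 4 * (π ^ 2 / 6)) := by
    have e : (fun n : ℕ => f (2 * n)) = fun n => 1 / 4 * f n := by
      funext n
      rw [hf]
      push_cast
      rw [mul_pow, one_div_mul_one_div]
      norm_num
    rw [e]
    exact h.mul_left _
  have ho : Summable (fun n : ℕ => f (2 * n + 1)) :=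
    h.summable.comp_injective (i := fun n => 2 * n + 1) fun a b hab => by simpa using hab
  have h2 := (he.even_add_odd ho.hasSum).unique h
  have e := ho.hasSum
  rw [show ∑' n : ℕ, f (2 * n + 1) = π ^ 2 / 8 by linarith, hf] at e
  simpa using e

/-- Expand the factor F(t) in its power series. All terms are nonnegative, so termwise integration
is legitimate and gives (4/π) ∑ 1/(2n+1)² = (4/π)(π²/8). -/
theorem integral_ellW : ∫ t in (0 : ℝ)..1, ellW t = π / 2 := by
  have hI : ∀ k : ℕ, IntervalIntegrable (fun t => halfCoeff k ^ 2 * (t ^ k * ellF (1 - t)))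
      volume 0 1 := fun k =>
    (intervalIntegrable_ellF_one_sub.continuousOn_mul (continuous_pow k).continuousOn).const_mul _
  have hnn : ∀ k : ℕ, ∀ t ∈ Ioo (0 : ℝ) 1, 0 ≤ halfCoeff k ^ 2 * (t ^ k * ellF (1 - t)) :=
    fun k t ht => by
      have := ellF_pos (one_sub_mem_Ioo ht).1.le (one_sub_mem_Ioo ht).2
      have := ht.1
      positivity
  have hval : ∀ k : ℕ, ∫ t in Ioo (0 : ℝ) 1, halfCoeff k ^ 2 * (t ^ k * ellF (1 - t)) =
      4 / π * (1 / (2 * k + 1) ^ 2) := fun k => by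
    rw [← integral_Ioc_eq_integral_Ioo, ← intervalIntegral.integral_of_le zero_le_one,
      intervalIntegral.integral_const_mul, halfCoeff_sq_mul_integral]
  have hsum := hasSum_one_div_odd_sq.mul_left (4 / π)
  have h := hasSum_integral_of_summable_integral_norm (μ := volume.restrict (Ioo (0 : ℝ) 1))
    (F := fun (k : ℕ) t => halfCoeff k ^ 2 * (t ^ k * ellF (1 - t)))
    (fun k => (intervalIntegrable_iff_integrableOn_Ioo_of_le zero_le_one).1 (hI k)) (by
      refine hsum.summable.congr fun k => ?_
      rw [← hval k]
      refine setIntegral_congr_fun measurableSet_Ioo fun t ht => ?_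
      exact (Real.norm_of_nonneg (hnn k t ht)).symm)
  simp only [hval] at h
  have h2 := h.unique hsum
  rw [intervalIntegral.integral_of_le zero_le_one, integral_Ioc_eq_integral_Ioo]
  refine Eq.trans (setIntegral_congr_fun measurableSet_Ioo fun t ht => ?_) (h2.trans ?_)
  · simp only [ellW, ellF, ← tsum_mul_right, mul_assoc]
  · field_simp
    norm_num

/-- The `L²` norm of `F(t) F(1 - t)` as a hypergeometric series. -/
theorem hasSum_halfCoeff_pow_eight :
    HasSum (fun n : ℕ => halfCoeff n ^ 8 * (1 + 4 * n))
      (4 / π ^ 2 * ∫ t in (0 : ℝ)..1, ellW t ^ 2) := by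
  have h := hasSum_sq_integral_mul_legendreQ memLp_ellW
  have hinj : Function.Injective fun n : ℕ => 2 * n := fun a b hab => by simpa using hab
  -- Odd degrees contribute nothing; at degree 2n the Parseval weight 2(2n) + 1 is the factor 1 + 4n
  -- of the series.
  have h2 := (hinj.hasSum_iff (f := fun n : ℕ => (2 * (n : ℝ) + 1) *
    (∫ t in (0 : ℝ)..1, ellW t * (legendreQ n).eval t) ^ 2) (fun n hn => by
      have : ¬ Even n := fun ⟨k, hk⟩ => hn ⟨k, by simp; omega⟩
      obtain ⟨k, rfl⟩ := Nat.not_even_iff_odd.1 this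
      rw [integral_ellW_mul_legendreQ_odd]; simp)).2 h
  have h3 := h2.mul_left (4 / π ^ 2)
  convert! h3 using 2 with n
  simp only [Function.comp, integral_ellW_mul_legendreQ_even, integral_ellW]
  push_cast
  field_simp
  ring

/-! ### The twelfth power of the eta function and its period relation -/

/-- The twelfth power of the Dedekind eta function. -/
def etaPow (τ : ℂ) : ℂ := ModularForm.eta τ ^ 12

theorem etaPow_add_one (τ : ℂ) : etaPow (τ + 1) = -etaPow τ := by
  have h1 : ∀ n, ModularForm.eta_q n (τ + 1) = ModularForm.eta_q n τ := by
    intro n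
    rw [ModularForm.eta_q_eq_pow, ModularForm.eta_q_eq_pow, mul_add, mul_one, Complex.exp_add,
      Complex.exp_two_pi_mul_I, mul_one]
  have h2 : Function.Periodic.qParam 24 (τ + 1) ^ 12 = -Function.Periodic.qParam 24 τ ^ 12 := by
    simp only [Function.Periodic.qParam]
    rw [← Complex.exp_nat_mul, ← Complex.exp_nat_mul,
      show ((12 : ℕ) : ℂ) * (2 * π * Complex.I * (τ + 1) / (24 : ℝ)) =
        (12 : ℕ) * (2 * π * Complex.I * τ / (24 : ℝ)) + π * Complex.I by push_cast; ring,
      Complex.exp_add, Complex.exp_pi_mul_I]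
    ring
  simp only [etaPow, ModularForm.eta, h1, mul_pow, h2]
  ring

theorem etaPow_sub_one (τ : ℂ) : etaPow (τ - 1) = -etaPow τ := by
  have h := etaPow_add_one (τ - 1)
  rw [sub_add_cancel] at h
  rw [h, neg_neg]

theorem complex_sqrt_sq (z : ℂ) : Complex.sqrt z ^ 2 = z := by
  rw [Complex.sqrt, ← Complex.cpow_nat_mul]
  norm_num

theorem etaPow_neg_one_div {τ : ℂ} (hτ : 0 < τ.im) : etaPow (-1 / τ) = -τ ^ 6 * etaPow τ := by
  have h := ModularForm.eta_comp_eq_csqrt_I_inv (x := τ) hτ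
  simp only [Function.comp, Pi.smul_apply, Pi.mul_apply, smul_eq_mul] at h
  have e : ∀ z : ℂ, Complex.sqrt z ^ 12 = z ^ 6 := fun z => by
    rw [show 12 = 2 * 6 by norm_num, pow_mul, complex_sqrt_sq]
  rw [etaPow, h, mul_pow, mul_pow, inv_pow, e, e, etaPow,
    show Complex.I ^ 6 = -1 by rw [show 6 = 2 * 3 by norm_num, pow_mul, Complex.I_sq]; norm_num]
  ring

theorem differentiableAt_etaPow {τ : ℂ} (hτ : 0 < τ.im) : DifferentiableAt ℂ etaPow τ :=
  (ModularForm.differentiableAt_eta_of_mem_upperHalfPlaneSet hτ).pow 12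

/-- Read off from the discriminant: |η¹²|² = |Δ| = |q| times a product tending to 1, hence
eventually below 4. The square root produces the factor 2 and the exponent -π Im τ. -/
theorem exists_norm_etaPow_le :
    ∃ A : ℝ, ∀ τ : ℂ, A ≤ τ.im → ‖etaPow τ‖ ≤ 2 * Real.exp (-π * τ.im) := by
  have h := ModularForm.tendsto_atImInfty_tprod_one_sub_eta_q_pow.norm
  have h2 := h.eventually (gt_mem_nhds (show ‖(1 : ℂ)‖ < 4 by norm_num))
  obtain ⟨A, hA⟩ := (UpperHalfPlane.atImInfty_mem _).1 h2
  refine ⟨max A 1, fun τ hτ => ?_⟩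
  have hpos : 0 < τ.im := one_pos.trans_le ((le_max_right _ _).trans hτ)
  have h3 := hA ⟨τ, hpos⟩ ((le_max_left _ _).trans hτ)
  have h4 := ModularForm.discriminant_eq_q_prod ⟨τ, hpos⟩
  have h5 : ‖etaPow τ‖ ^ 2 ≤ (2 * Real.exp (-π * τ.im)) ^ 2 := by
    rw [← norm_pow, etaPow, ← pow_mul]
    change ‖ModularForm.discriminant ⟨τ, hpos⟩‖ ≤ _
    rw [h4, norm_mul, Function.Periodic.norm_qParam, mul_pow, ← Real.exp_nat_mul, mul_comm]
    refine mul_le_mul ((le_of_lt h3).trans (by norm_num)) (le_of_eq ?_) (Real.exp_pos _).le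
      (by norm_num)
    congr 1
    change -2 * π * τ.im / 1 = _
    push_cast
    ring
  exact le_of_sq_le_sq h5 (by positivity)

theorem tendsto_pow_mul_exp_neg_pi_mul (n : ℕ) :
    Tendsto (fun y : ℝ => y ^ n * Real.exp (-π * y)) atTop (𝓝 0) := by
  refine (tendsto_rpow_mul_exp_neg_mul_atTop_nhds_zero n π Real.pi_pos).congr fun y => ?_
  rw [Real.rpow_natCast]

theorem continuousOn_etaPow_vertical : ContinuousOn (fun y : ℝ => etaPow (Complex.I * y)) (Ioi 0) := by
  intro y hy
  have h : ContinuousAt etaPow (Complex.I * y) :=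
    (differentiableAt_etaPow (by simpa using hy)).continuousAt
  exact (h.comp (f := fun y : ℝ => Complex.I * (y : ℂ)) (by fun_prop)).continuousWithinAt

theorem etaPow_vertical_inv {y : ℝ} (hy : 0 < y) :
    etaPow (Complex.I * (y⁻¹ : ℝ)) = (y : ℂ) ^ 6 * etaPow (Complex.I * y) := by
  have hy' : (y : ℂ) ≠ 0 := by exact_mod_cast hy.ne'
  have h := etaPow_neg_one_div (τ := Complex.I * y) (by simpa using hy)
  have e : -1 / (Complex.I * y) = Complex.I * (y⁻¹ : ℝ) := by
    push_cast
    field_simp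
    rw [Complex.I_sq]
  rw [e] at h
  rw [h, mul_pow, show Complex.I ^ 6 = -1 by
    rw [show 6 = 2 * 3 by norm_num, pow_mul, Complex.I_sq]; norm_num]
  ring

/-- Exponential decay handles infinity. Near 0 the inversion formula turns that decay into
boundedness, which suffices for Re s > 0. -/
theorem mellinConvergent_etaPow {s : ℂ} (hs : 0 < s.re) :
    MellinConvergent (fun y : ℝ => etaPow (Complex.I * y)) s := by
  obtain ⟨A, hA⟩ := exists_norm_etaPow_le
  have htop : (fun y : ℝ => etaPow (Complex.I * y)) =O[atTop] fun y : ℝ => Real.exp (-π * y) := by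
    refine IsBigO.of_bound 2 ?_
    filter_upwards [eventually_ge_atTop A] with y hy
    have := hA (Complex.I * y) (by simpa using hy)
    rw [Real.norm_of_nonneg (Real.exp_pos _).le]
    simpa using this
  refine mellinConvergent_of_isBigO_rpow_exp (b := 0) Real.pi_pos
    (continuousOn_etaPow_vertical.locallyIntegrableOn measurableSet_Ioi) htop ?_ hs
  simp only [neg_zero, Real.rpow_zero]
  have h2 : (fun y : ℝ => (y : ℂ) ^ 6 * etaPow (Complex.I * y)) =O[atTop] fun _ => (1 : ℝ) := by
    refine IsBigO.trans (g := fun y : ℝ => y ^ 6 * Real.exp (-π * y)) (IsBigO.mul ?_ htop)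
      ((tendsto_pow_mul_exp_neg_pi_mul 6).isBigO_one ℝ)
    exact IsBigO.of_bound 1 (.of_forall fun y => by simp)
  have h3 := h2.comp_tendsto tendsto_inv_nhdsGT_zero
  refine h3.congr' ?_ (.of_forall fun _ => rfl)
  filter_upwards [self_mem_nhdsWithin] with y hy
  have hy : 0 < y := hy
  have := etaPow_vertical_inv (inv_pos.2 hy)
  rw [inv_inv] at this
  exact this.symm

/-- The Mellin transform of `η¹²` along the imaginary axis. -/
def etaMellin (s : ℂ) : ℂ := mellin (fun y : ℝ => etaPow (Complex.I * y)) s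

/-- The functional equation M(s) = M(6 - s), from y ↦ 1/y. -/
theorem etaMellin_neg (s : ℂ) : etaMellin (-s) = etaMellin (s + 6) := by
  rw [etaMellin, etaMellin, ← mellin_comp_inv, ← mellin_cpow_smul]
  refine setIntegral_congr_fun measurableSet_Ioi fun y hy => ?_
  simp only [smul_eq_mul]
  rw [etaPow_vertical_inv hy]
  norm_cast

theorem integrableOn_etaPow_mul_pow (j : ℕ) :
    IntegrableOn (fun y : ℝ => etaPow (Complex.I * y) * (y : ℂ) ^ j) (Ioi 0) := by
  have h := mellinConvergent_etaPow (s := j + 1) (by simp; positivity)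
  refine h.congr_fun (fun y _ => ?_) measurableSet_Ioi
  simp [mul_comm]

theorem integral_etaPow_mul_pow (j : ℕ) :
    ∫ y : ℝ in Ioi 0, etaPow (Complex.I * y) * (y : ℂ) ^ j = etaMellin (j + 1) := by
  refine setIntegral_congr_fun measurableSet_Ioi fun y _ => ?_
  simp [mul_comm]

/-- The form `η(τ)¹² (τ² - τ + 1)²`, whose differential is invariant under `τ ↦ 1 / (1 - τ)`. -/
def etaForm (τ : ℂ) : ℂ := etaPow τ * (τ ^ 2 - τ + 1) ^ 2

/-! ### The relation between periods. -/

theorem differentiableAt_etaForm {τ : ℂ} (hτ : 0 < τ.im) : DifferentiableAt ℂ etaForm τ :=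
  (differentiableAt_etaPow hτ).mul (by fun_prop)

theorem one_sub_ne_zero_of_im_pos {τ : ℂ} (hτ : 0 < τ.im) : 1 - τ ≠ 0 := by
  intro h
  have := congrArg Complex.im h
  simp at this
  linarith

/-- The map has order three and sends τ² - τ + 1 to its quotient by (1 - τ)²; the signs of η¹² under
translation and inversion cancel. The remaining (1 - τ)² offsets the derivative 1/(1 - τ)² of the
map. -/
theorem etaForm_one_div_one_sub {τ : ℂ} (hτ : 0 < τ.im) :
    etaForm (1 / (1 - τ)) = (1 - τ) ^ 2 * etaForm τ := by
  have h0 := one_sub_ne_zero_of_im_pos hτ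
  have h := etaPow_neg_one_div (τ := τ - 1) (by simpa using hτ)
  rw [etaPow_sub_one, show -1 / (τ - 1) = 1 / (1 - τ) by
    rw [← neg_sub 1 τ, div_neg, neg_div, neg_neg]] at h
  rw [etaForm, etaForm, h]
  field_simp
  ring

theorem etaForm_neg_one_div {τ : ℂ} (hτ : 0 < τ.im) :
    etaForm (-1 / τ) = τ ^ 2 * etaForm (1 + τ) := by
  have h0 : τ ≠ 0 := by rintro rfl; simp at hτ
  rw [etaForm, etaForm, etaPow_neg_one_div hτ, add_comm 1 τ, etaPow_add_one]
  field_simp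
  ring

/-- A disc in the upper half plane stable under `τ ↦ 1 / (1 - τ)`. -/
theorem mem_stableDisc_iff (τ : ℂ) :
    τ ∈ Metric.ball (1 / 2 + 3 / 2 * Complex.I : ℂ) (√(3 / 2)) ↔
      Complex.normSq τ - τ.re + 1 < 3 * τ.im := by
  rw [mem_ball_iff_norm, ← abs_of_nonneg (norm_nonneg _), ← abs_of_nonneg (Real.sqrt_nonneg _),
    ← sq_lt_sq, Real.sq_sqrt (by norm_num), ← Complex.normSq_eq_norm_sq, Complex.normSq_apply,
    Complex.normSq_apply]
  simp
  constructor <;> intro h <;> nlinarith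

theorem im_pos_of_mem_stableDisc {τ : ℂ}
    (h : τ ∈ Metric.ball (1 / 2 + 3 / 2 * Complex.I : ℂ) (√(3 / 2))) : 0 < τ.im := by
  rw [mem_stableDisc_iff, Complex.normSq_apply] at h
  nlinarith [sq_nonneg (τ.re - 1 / 2), sq_nonneg τ.im]

/-- The ratio (|τ|² - Re τ + 1)/Im τ is invariant, since the map divides numerator and denominator
by |1 - τ|². The disc is thus a hyperbolic disc about the fixed point e^(iπ/3). -/
theorem one_div_one_sub_mem_stableDisc {τ : ℂ}
    (h : τ ∈ Metric.ball (1 / 2 + 3 / 2 * Complex.I : ℂ) (√(3 / 2))) :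
    1 / (1 - τ) ∈ Metric.ball (1 / 2 + 3 / 2 * Complex.I : ℂ) (√(3 / 2)) := by
  have h0 := one_sub_ne_zero_of_im_pos (im_pos_of_mem_stableDisc h)
  rw [mem_stableDisc_iff] at h ⊢
  have hn : 0 < Complex.normSq (1 - τ) := Complex.normSq_pos.2 h0
  rw [one_div, Complex.normSq_inv, Complex.inv_re, Complex.inv_im]
  have e : Complex.normSq (1 - τ) = 1 - 2 * τ.re + Complex.normSq τ := by
    simp [Complex.normSq_apply]; ring
  rw [← mul_lt_mul_iff_of_pos_right hn]
  simp only [Complex.sub_re, Complex.sub_im, Complex.one_re, Complex.one_im]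
  field_simp
  linarith

/-- For a primitive Φ on the stable disc, Φ(1/(1 - τ)) - Φ(τ) is constant. Summed along the orbit i,
(1+i)/2, 1+i of period three it gives zero, so the constant is zero and Φ(1+i) = Φ(i). -/
theorem integral_etaForm_horizontal : ∫ x in (0 : ℝ)..1, etaForm (x + Complex.I) = 0 := by
  set D := Metric.ball (1 / 2 + 3 / 2 * Complex.I : ℂ) (√(3 / 2)) with hD
  have hdiff : DifferentiableOn ℂ etaForm D := fun τ hτ =>
    (differentiableAt_etaForm (im_pos_of_mem_stableDisc hτ)).differentiableWithinAt
  obtain ⟨Φ, hΦ⟩ := hdiff.isExactOn_ball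
  have hU : ∀ τ ∈ D, HasDerivAt (fun τ => Φ (1 / (1 - τ)) - Φ τ) 0 τ := by
    intro τ hτ
    have h0 := one_sub_ne_zero_of_im_pos (im_pos_of_mem_stableDisc hτ)
    have hinner : HasDerivAt (fun τ : ℂ => 1 / (1 - τ)) (1 / (1 - τ) ^ 2) τ := by
      have := ((hasDerivAt_id τ).const_sub 1).inv h0
      simp only [id, neg_neg] at this
      simpa only [one_div] using! this
    have h := (HasDerivAt.comp τ (hΦ _ (one_div_one_sub_mem_stableDisc hτ)) hinner).sub (hΦ τ hτ)
    refine h.congr_deriv ?_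
    rw [etaForm_one_div_one_sub (im_pos_of_mem_stableDisc hτ)]
    field_simp
    ring
  have hconst : ∀ x ∈ D, ∀ y ∈ D, Φ (1 / (1 - x)) - Φ x = Φ (1 / (1 - y)) - Φ y :=
    fun x hx y hy => Metric.isOpen_ball.is_const_of_deriv_eq_zero
      (convex_ball _ _).isPreconnected
      (fun τ hτ => (hU τ hτ).differentiableAt.differentiableWithinAt)
      (fun τ hτ => (hU τ hτ).deriv) hx hy
  have hI : Complex.I ∈ D := by
    rw [hD, mem_stableDisc_iff]; simp; norm_num
  have hI1 := one_div_one_sub_mem_stableDisc hI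
  have hI2 := one_div_one_sub_mem_stableDisc hI1
  have e0 : (1 - Complex.I) ≠ 0 := one_sub_ne_zero_of_im_pos (by simp)
  have e1 : 1 / (1 - 1 / (1 - Complex.I)) = 1 + Complex.I := by
    have : 1 - 1 / (1 - Complex.I) ≠ 0 :=
      one_sub_ne_zero_of_im_pos (im_pos_of_mem_stableDisc hI1)
    rw [div_eq_iff this]
    field_simp
    ring_nf
    rw [Complex.I_sq]
    ring
  have e2 : 1 / (1 - (1 + Complex.I)) = Complex.I := by
    have : (1 - (1 + Complex.I)) ≠ 0 := by simp
    rw [div_eq_iff this]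
    ring_nf
    rw [Complex.I_sq]
    ring
  rw [e1] at hI2
  have c1 := hconst _ hI1 _ hI
  have c2 := hconst _ hI2 _ hI
  rw [e1] at c1
  rw [e2] at c2
  have hline : ∀ x ∈ uIcc (0 : ℝ) 1, (x : ℂ) + Complex.I ∈ D := by
    intro x hx
    rw [uIcc_of_le zero_le_one] at hx
    rw [hD, mem_stableDisc_iff, Complex.normSq_apply]
    simp
    nlinarith [hx.1, hx.2]
  have hFTC := intervalIntegral.integral_eq_sub_of_hasDerivAt (a := (0 : ℝ)) (b := 1)
    (f := fun x : ℝ => Φ (x + Complex.I)) (f' := fun x : ℝ => etaForm (x + Complex.I))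
    (fun x hx => by
      have h := hΦ _ (hline x hx)
      have h2 : HasDerivAt (fun x : ℝ => (x : ℂ) + Complex.I) 1 x :=
        (Complex.ofRealCLM.hasDerivAt (x := x)).add_const Complex.I
      simpa using! h.comp x h2)
    (ContinuousOn.intervalIntegrable fun x hx => by
      have h : ContinuousAt etaForm (x + Complex.I) :=
        (differentiableAt_etaForm (by simp)).continuousAt
      exact (h.comp (f := fun x : ℝ => (x : ℂ) + Complex.I) (by fun_prop)).continuousWithinAt)
  rw [hFTC]
  simp only [Complex.ofReal_one, Complex.ofReal_zero, zero_add]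
  linear_combination (-2 / 3 : ℂ) * c2 + (1 / 3) * c1

theorem etaForm_vertical (y : ℝ) : etaForm (Complex.I * y) =
    etaPow (Complex.I * y) * (y : ℂ) ^ 4 + 2 * Complex.I * (etaPow (Complex.I * y) * (y : ℂ) ^ 3)
      - 3 * (etaPow (Complex.I * y) * (y : ℂ) ^ 2)
      - 2 * Complex.I * (etaPow (Complex.I * y) * (y : ℂ) ^ 1)
      + etaPow (Complex.I * y) * (y : ℂ) ^ 0 := by
  have h3 : Complex.I ^ 3 = -Complex.I := by rw [pow_succ, Complex.I_sq]; ring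
  have h4 : Complex.I ^ 4 = 1 := Complex.I_pow_four
  rw [etaForm]
  linear_combination (etaPow (Complex.I * y)) *
    (y ^ 4 * h4 - 2 * y ^ 3 * h3 + 3 * y ^ 2 * Complex.I_sq)

theorem etaForm_one_add_vertical (y : ℝ) : etaForm (1 + Complex.I * y) =
    -(etaPow (Complex.I * y) * (y : ℂ) ^ 4) + 2 * Complex.I * (etaPow (Complex.I * y) * (y : ℂ) ^ 3)
      + 3 * (etaPow (Complex.I * y) * (y : ℂ) ^ 2)
      - 2 * Complex.I * (etaPow (Complex.I * y) * (y : ℂ) ^ 1)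
      - etaPow (Complex.I * y) * (y : ℂ) ^ 0 := by
  have h3 : Complex.I ^ 3 = -Complex.I := by rw [pow_succ, Complex.I_sq]; ring
  have h4 : Complex.I ^ 4 = 1 := Complex.I_pow_four
  rw [etaForm, add_comm 1, etaPow_add_one]
  linear_combination -(etaPow (Complex.I * y)) *
    (y ^ 4 * h4 + 2 * y ^ 3 * h3 + 3 * y ^ 2 * Complex.I_sq)

theorem integrableOn_etaForm_vertical :
    IntegrableOn (fun y : ℝ => etaForm (Complex.I * y)) (Ioi 0) := by
  simp only [etaForm_vertical]
  exact ((((integrableOn_etaPow_mul_pow 4).add ((integrableOn_etaPow_mul_pow 3).const_mul _)).sub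
    ((integrableOn_etaPow_mul_pow 2).const_mul _)).sub
    ((integrableOn_etaPow_mul_pow 1).const_mul _)).add (integrableOn_etaPow_mul_pow 0)

theorem integrableOn_etaForm_one_add_vertical :
    IntegrableOn (fun y : ℝ => etaForm (1 + Complex.I * y)) (Ioi 0) := by
  simp only [etaForm_one_add_vertical]
  exact ((((integrableOn_etaPow_mul_pow 4).neg.add ((integrableOn_etaPow_mul_pow 3).const_mul _)).add
    ((integrableOn_etaPow_mul_pow 2).const_mul _)).sub
    ((integrableOn_etaPow_mul_pow 1).const_mul _)).sub (integrableOn_etaPow_mul_pow 0)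

theorem tendsto_integral_etaForm_horizontal :
    Tendsto (fun Y : ℝ => ∫ x in (0 : ℝ)..1, etaForm (x + Y * Complex.I)) atTop (𝓝 0) := by
  obtain ⟨A, hA⟩ := exists_norm_etaPow_le
  have hlim : Tendsto (fun Y : ℝ => 512 * (Y ^ 4 * Real.exp (-π * Y))) atTop (𝓝 0) := by
    simpa using (tendsto_pow_mul_exp_neg_pi_mul 4).const_mul 512
  refine squeeze_zero_norm' ?_ hlim
  filter_upwards [eventually_ge_atTop A, eventually_ge_atTop 1] with Y hY hY1
  have hb : ∀ x ∈ uIoc (0 : ℝ) 1, ‖etaForm (x + Y * Complex.I)‖ ≤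
      512 * (Y ^ 4 * Real.exp (-π * Y)) := by
    intro x hx
    rw [uIoc_of_le zero_le_one] at hx
    have h1 := hA (x + Y * Complex.I) (by simpa using hY)
    have him : ((x : ℂ) + Y * Complex.I).im = Y := by simp
    rw [him] at h1
    have h2 : ‖(x : ℂ) + Y * Complex.I‖ ≤ 2 * Y := by
      refine (norm_add_le _ _).trans ?_
      simp only [Complex.norm_mul, Complex.norm_real, Complex.norm_I, mul_one, Real.norm_eq_abs]
      rw [abs_of_pos hx.1, abs_of_pos (by linarith)]
      linarith [hx.2]
    set τ := (x : ℂ) + Y * Complex.I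
    have h3 : ‖τ ^ 2 - τ + 1‖ ≤ 16 * Y ^ 2 := by
      calc ‖τ ^ 2 - τ + 1‖ ≤ ‖τ ^ 2‖ + ‖τ‖ + ‖(1 : ℂ)‖ :=
            (norm_add_le _ _).trans (by gcongr; exact norm_sub_le _ _)
        _ ≤ (2 * Y) ^ 2 + 2 * Y + 1 := by rw [norm_pow, norm_one]; gcongr
        _ ≤ 16 * Y ^ 2 := by nlinarith
    rw [etaForm, norm_mul, norm_pow]
    calc ‖etaPow τ‖ * ‖τ ^ 2 - τ + 1‖ ^ 2 ≤ (2 * Real.exp (-π * Y)) * (16 * Y ^ 2) ^ 2 := by gcongr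
      _ = _ := by ring
  simpa using intervalIntegral.norm_integral_le_of_norm_le_const hb

/-- Cauchy's theorem on the rectangle with corners i and 1 + iY: the bottom side vanishes by the
orbit argument, and the top side tends to zero. -/
theorem integral_Ioi_one_etaForm :
    ∫ y : ℝ in Ioi 1, etaForm (Complex.I * y) = ∫ y : ℝ in Ioi 1, etaForm (1 + Complex.I * y) := by
  have hrect : ∀ᶠ Y : ℝ in atTop, (∫ x in (0 : ℝ)..1, etaForm (x + Y * Complex.I)) =
      Complex.I * (∫ y in (1 : ℝ)..Y, etaForm (1 + Complex.I * y)) -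
      Complex.I * ∫ y in (1 : ℝ)..Y, etaForm (Complex.I * y) := by
    filter_upwards [eventually_ge_atTop 1] with Y hY
    have h := Complex.integral_boundary_rect_eq_zero_of_differentiableOn etaForm Complex.I
      (1 + Y * Complex.I) (fun τ hτ => (differentiableAt_etaForm (by
        have := hτ.2
        simp only [mem_preimage, Complex.I_im, Complex.add_im, Complex.one_im, Complex.mul_im,
          Complex.ofReal_re, Complex.ofReal_im, mul_one, zero_mul, add_zero, zero_add,
          uIcc_of_le hY] at this
        exact one_pos.trans_le this.1)).differentiableWithinAt)
    simp only [Complex.I_re, Complex.I_im, Complex.add_re, Complex.add_im, Complex.one_re,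
      Complex.one_im, Complex.mul_re, Complex.mul_im, Complex.ofReal_re, Complex.ofReal_im,
      mul_zero, mul_one, sub_zero, add_zero, zero_add, Complex.ofReal_one, Complex.ofReal_zero,
      one_mul, smul_eq_mul, integral_etaForm_horizontal] at h
    simp only [mul_comm Complex.I (Complex.ofReal _)]
    linear_combination -h
  have hsub : Ioi (1 : ℝ) ⊆ Ioi 0 := Ioi_subset_Ioi zero_le_one
  have h1 := intervalIntegral_tendsto_integral_Ioi 1
    (integrableOn_etaForm_one_add_vertical.mono_set hsub) tendsto_id
  have h2 := intervalIntegral_tendsto_integral_Ioi 1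
    (integrableOn_etaForm_vertical.mono_set hsub) tendsto_id
  have h3 := ((h1.const_mul Complex.I).sub (h2.const_mul Complex.I)).congr'
    (hrect.mono fun _ h => h.symm)
  have h4 := tendsto_nhds_unique h3 tendsto_integral_etaForm_horizontal
  rw [← mul_sub] at h4
  exact (sub_eq_zero.1 ((mul_eq_zero.1 h4).resolve_left Complex.I_ne_zero)).symm

/-- Substitution y ↦ 1/y, which carries the lower part of the line Re τ = 0 to the upper part of Re
τ = 1. -/
theorem integral_Ioo_etaForm :
    ∫ y : ℝ in Ioo 0 1, etaForm (Complex.I * y) =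
      -∫ y : ℝ in Ioi 1, etaForm (1 + Complex.I * y) := by
  have himg : (fun y : ℝ => y⁻¹) '' Ioi 1 = Ioo 0 1 := by
    rw [image_inv_eq_inv, Set.inv_Ioi₀ one_pos, inv_one]
  have h := integral_image_eq_integral_abs_deriv_smul (s := Ioi (1 : ℝ)) measurableSet_Ioi
    (f := fun y : ℝ => y⁻¹) (f' := fun y => -(y ^ 2)⁻¹)
    (fun y hy => (hasDerivAt_inv (zero_lt_one.trans hy).ne').hasDerivWithinAt)
    inv_injective.injOn (fun y : ℝ => etaForm (Complex.I * y))
  rw [himg] at h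
  rw [h, ← integral_neg]
  refine setIntegral_congr_fun measurableSet_Ioi fun y hy => ?_
  have hy : 0 < y := zero_lt_one.trans hy
  have hy' : (y : ℂ) ≠ 0 := by exact_mod_cast hy.ne'
  have e : Complex.I * (y⁻¹ : ℝ) = -1 / (Complex.I * y) := by
    push_cast
    field_simp
    rw [Complex.I_sq]
  rw [e, etaForm_neg_one_div (by simpa using hy), abs_neg, abs_of_pos (by positivity),
    Complex.real_smul, mul_pow, Complex.I_sq]
  push_cast
  field_simp

theorem integral_etaForm_vertical : ∫ y : ℝ in Ioi 0, etaForm (Complex.I * y) = 0 := by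
  rw [← Ioc_union_Ioi_eq_Ioi (zero_le_one (α := ℝ)), setIntegral_union
    (Ioc_disjoint_Ioi le_rfl) measurableSet_Ioi
    (integrableOn_etaForm_vertical.mono_set Ioc_subset_Ioi_self)
    (integrableOn_etaForm_vertical.mono_set (Ioi_subset_Ioi zero_le_one)),
    integral_Ioc_eq_integral_Ioo, integral_Ioo_etaForm, integral_Ioi_one_etaForm]
  ring

/-- The Eichler–Shimura relation between the even periods of `η¹²`. -/
theorem two_mul_etaMellin_five : 2 * etaMellin 5 = 3 * etaMellin 3 := by
  have h := integral_etaForm_vertical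
  simp only [etaForm_vertical] at h
  have i := integrableOn_etaPow_mul_pow
  have j : ∀ (c : ℂ) (k : ℕ), Integrable (fun y : ℝ => c * (etaPow (Complex.I * y) * (y : ℂ) ^ k))
      (volume.restrict (Ioi 0)) := fun c k => (i k).const_mul c
  rw [integral_add ((((i 4).fun_add (j _ 3)).fun_sub (j _ 2)).fun_sub (j _ 1)) (i 0),
    integral_sub (((i 4).fun_add (j _ 3)).fun_sub (j _ 2)) (j _ 1),
    integral_sub ((i 4).fun_add (j _ 3)) (j _ 2), integral_add (i 4) (j _ 3), integral_const_mul,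
    integral_const_mul, integral_const_mul, integral_etaPow_mul_pow, integral_etaPow_mul_pow,
    integral_etaPow_mul_pow, integral_etaPow_mul_pow, integral_etaPow_mul_pow] at h
  -- The expansion reads M(5) + 2i M(4) - 3 M(3) - 2i M(2) + M(1) = 0; the functional equation gives
  -- M(1) = M(5) and M(2) = M(4).
  have e1 := etaMellin_neg (-1)
  have e2 := etaMellin_neg (-2)
  norm_num at h e1 e2
  rw [e1, e2] at h
  linear_combination h

/-! ### Theta constants -/

/-- The theta constant `θ₂`. -/
def thetaTwo (τ : ℂ) : ℂ := Complex.exp (π * Complex.I * τ / 4) * jacobiTheta₂ (τ / 2) τ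

/-- The theta constant `θ₃`. -/
def thetaThree (τ : ℂ) : ℂ := jacobiTheta₂ 0 τ

/-- The theta constant `θ₄`. -/
def thetaFour (τ : ℂ) : ℂ := jacobiTheta₂ (1 / 2) τ

theorem differentiableAt_thetaTwo {τ : ℂ} (hτ : 0 < τ.im) : DifferentiableAt ℂ thetaTwo τ := by
  have h := (hasFDerivAt_jacobiTheta₂ (τ / 2) hτ).differentiableAt
  have h2 : DifferentiableAt ℂ (fun τ : ℂ => (τ / 2, τ)) τ := by fun_prop
  exact DifferentiableAt.mul (by fun_prop) (h.comp (f := fun τ : ℂ => (τ / 2, τ)) τ h2)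

theorem differentiableAt_thetaThree {τ : ℂ} (hτ : 0 < τ.im) : DifferentiableAt ℂ thetaThree τ :=
  differentiableAt_jacobiTheta₂_snd 0 hτ

theorem differentiableAt_thetaFour {τ : ℂ} (hτ : 0 < τ.im) : DifferentiableAt ℂ thetaFour τ :=
  differentiableAt_jacobiTheta₂_snd (1 / 2) hτ

theorem cexp_pi_mul_I_mul_even (n : ℤ) : Complex.exp (π * Complex.I * (n ^ 2 + n)) = 1 := by
  obtain ⟨k, hk⟩ := (Int.even_mul_succ_self n)
  have e : (n : ℂ) ^ 2 + n = k + k := by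
    have : n ^ 2 + n = k + k := by rw [← hk]; ring
    exact_mod_cast this
  rw [e, show (π : ℂ) * Complex.I * (k + k) = k * (2 * π * Complex.I) by ring,
    Complex.exp_int_mul_two_pi_mul_I]

theorem thetaTwo_add_one (τ : ℂ) :
    thetaTwo (τ + 1) = Complex.exp (π * Complex.I / 4) * thetaTwo τ := by
  have h : jacobiTheta₂ ((τ + 1) / 2) (τ + 1) = jacobiTheta₂ (τ / 2) τ := by
    refine tsum_congr fun n => ?_
    rw [jacobiTheta₂_term, jacobiTheta₂_term, show 2 * π * Complex.I * n * ((τ + 1) / 2) +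
      π * Complex.I * n ^ 2 * (τ + 1) = 2 * π * Complex.I * n * (τ / 2) +
      π * Complex.I * n ^ 2 * τ + π * Complex.I * (n ^ 2 + n) by ring, Complex.exp_add,
      cexp_pi_mul_I_mul_even, mul_one]
  rw [thetaTwo, thetaTwo, h, ← mul_assoc, ← Complex.exp_add]
  congr 2
  ring

theorem thetaThree_add_one (τ : ℂ) : thetaThree (τ + 1) = thetaFour τ := by
  refine tsum_congr fun n => ?_
  have h := cexp_pi_mul_I_mul_even (-n)
  push_cast at h
  rw [jacobiTheta₂_term, jacobiTheta₂_term, show 2 * π * Complex.I * n * 0 +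
    π * Complex.I * n ^ 2 * (τ + 1) = 2 * π * Complex.I * n * (1 / 2) +
    π * Complex.I * n ^ 2 * τ + π * Complex.I * ((-n) ^ 2 + -n) by ring, Complex.exp_add, h, mul_one]

theorem thetaFour_add_one (τ : ℂ) : thetaFour (τ + 1) = thetaThree τ := by
  rw [← thetaThree_add_one, add_assoc, one_add_one_eq_two]
  exact jacobiTheta₂_add_right 0 τ

theorem cpow_half_sq (z : ℂ) : (z ^ (1 / 2 : ℂ)) ^ 2 = z := by
  rw [← Complex.cpow_nat_mul]
  norm_num

/-- Stated for the square, as are its two companions, so that no branch of the square root appears.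
-/
theorem thetaThree_neg_one_div {τ : ℂ} (hτ : 0 < τ.im) :
    thetaThree (-1 / τ) ^ 2 = -Complex.I * τ * thetaThree τ ^ 2 := by
  have hτ0 : τ ≠ 0 := by rintro rfl; simp at hτ
  have h0 : -Complex.I * τ ≠ 0 := mul_ne_zero (neg_ne_zero.2 Complex.I_ne_zero) hτ0
  have h := jacobiTheta₂_functional_equation 0 τ
  simp only [zero_div, ne_eq, OfNat.ofNat_ne_zero, not_false_eq_true, zero_pow, mul_zero,
    Complex.exp_zero, mul_one] at h
  rw [thetaThree, thetaThree, h, mul_pow, div_pow, cpow_half_sq, ← mul_assoc, one_pow,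
    mul_one_div_cancel h0, one_mul]

theorem thetaFour_neg_one_div {τ : ℂ} (hτ : 0 < τ.im) :
    thetaFour (-1 / τ) ^ 2 = -Complex.I * τ * thetaTwo τ ^ 2 := by
  have hτ0 : τ ≠ 0 := by rintro rfl; simp at hτ
  have h := jacobiTheta₂_functional_equation (τ / 2) τ
  have e : τ / 2 / τ = 1 / 2 := by field_simp
  rw [e] at h
  have e2 : Complex.exp (π * Complex.I * τ / 4) * Complex.exp (-π * Complex.I * (τ / 2) ^ 2 / τ)
      = 1 := by
    rw [← Complex.exp_add, ← Complex.exp_zero]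
    congr 1
    field_simp
    ring
  have h0 : -Complex.I * τ ≠ 0 := mul_ne_zero (neg_ne_zero.2 Complex.I_ne_zero) hτ0
  rw [thetaFour, thetaTwo, h, show ∀ a b c d e : ℂ, a * (b * (1 / c * d * e)) ^ 2 =
    (b * d) ^ 2 * (a / c ^ 2 * e ^ 2) by intros; ring, e2, cpow_half_sq, div_self h0]
  ring

theorem thetaTwo_neg_one_div {τ : ℂ} (hτ : 0 < τ.im) :
    thetaTwo (-1 / τ) ^ 2 = -Complex.I * τ * thetaFour τ ^ 2 := by
  have hτ0 : τ ≠ 0 := by rintro rfl; simp at hτ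
  have him : 0 < (-1 / τ).im := by
    rw [neg_div, one_div, Complex.neg_im, Complex.inv_im, neg_div, neg_neg]
    exact div_pos hτ (Complex.normSq_pos.2 hτ0)
  have h := thetaFour_neg_one_div him
  rw [show -1 / (-1 / τ) = τ by field_simp] at h
  rw [h]
  field_simp
  rw [Complex.I_sq]
  ring

/-- The filter of complex numbers whose imaginary part tends to infinity. -/
def imAtTop : Filter ℂ := comap Complex.im atTop

/-! ### Limits of the theta constants at i∞. -/

theorem summable_exp_neg_pi_mul_sq_add :
    Summable fun n : ℤ => Real.exp (-π * (n ^ 2 + n)) := by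
  have h := (hasSum_jacobiTheta₂_term (Complex.I / 2) (τ := Complex.I) (by simp)).summable.norm
  refine h.congr fun n => ?_
  rw [norm_jacobiTheta₂_term]
  congr 1
  simp
  ring

/-- Dominated convergence: only terms with zero exponent survive. For Im τ ≥ 1 the lower bound n² ±
n on the exponent gives a summable majorant; adding both signs yields one bound for either
alternative. -/
theorem tendsto_tsum_mul_cexp (m : ℤ → ℤ) (ε : ℤ → ℂ) (hε : ∀ n, ‖ε n‖ = 1) (hm : ∀ n, 0 ≤ m n)
    (hm2 : ∀ n, n ^ 2 + n ≤ m n ∨ n ^ 2 - n ≤ m n) :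
    Tendsto (fun τ : ℂ => ∑' n : ℤ, ε n * Complex.exp (π * Complex.I * m n * τ)) imAtTop
      (𝓝 (∑' n : ℤ, if m n = 0 then ε n else 0)) := by
  have hnorm : ∀ (n : ℤ) (τ : ℂ), ‖ε n * Complex.exp (π * Complex.I * m n * τ)‖ =
      Real.exp (-(π * m n) * τ.im) := by
    intro n τ
    rw [norm_mul, hε, one_mul, Complex.norm_exp]
    congr 1
    simp
  refine tendsto_tsum_of_dominated_convergence
    (bound := fun n : ℤ => Real.exp (-π * (n ^ 2 + n)) + Real.exp (-π * ((-n : ℤ) ^ 2 + (-n : ℤ))))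
    ?_ ?_ ?_
  · exact summable_exp_neg_pi_mul_sq_add.add
      ((Equiv.neg ℤ).summable_iff.2 summable_exp_neg_pi_mul_sq_add)
  · intro n
    split_ifs with h
    · simpa [h] using tendsto_const_nhds
    · have h1 : (0 : ℝ) < π * m n := by
        have : (0 : ℝ) < m n := by exact_mod_cast lt_of_le_of_ne (hm n) (Ne.symm h)
        positivity
      rw [tendsto_zero_iff_norm_tendsto_zero]
      simp only [hnorm]
      refine Real.tendsto_exp_atBot.comp ?_
      exact (tendsto_comap (f := Complex.im)).const_mul_atTop_of_neg (neg_lt_zero.2 h1)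
  · have : ∀ᶠ τ : ℂ in imAtTop, 1 ≤ τ.im := tendsto_comap.eventually (eventually_ge_atTop 1)
    filter_upwards [this] with τ hτ n
    rw [hnorm]
    have h0 : (0 : ℝ) ≤ m n := by exact_mod_cast hm n
    have h1 : -(π * m n) * τ.im ≤ -π * m n := by
      nlinarith [mul_nonneg (mul_nonneg Real.pi_pos.le h0) (sub_nonneg.2 hτ)]
    refine (Real.exp_le_exp.2 h1).trans ?_
    rcases hm2 n with h | h
    · have h : (n : ℝ) ^ 2 + n ≤ m n := by exact_mod_cast h
      refine le_add_of_le_of_nonneg (Real.exp_le_exp.2 ?_) (Real.exp_pos _).le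
      nlinarith [Real.pi_pos]
    · have h : (n : ℝ) ^ 2 - n ≤ m n := by exact_mod_cast h
      refine le_add_of_nonneg_of_le (Real.exp_pos _).le (Real.exp_le_exp.2 ?_)
      push_cast
      nlinarith [Real.pi_pos]

theorem sq_add_self_le_or (n : ℤ) : n ^ 2 + n ≤ n ^ 2 ∨ n ^ 2 - n ≤ n ^ 2 := by
  rcases le_total n 0 with h | h
  · left; linarith
  · right; linarith

theorem tendsto_thetaThree : Tendsto thetaThree imAtTop (𝓝 1) := by
  have h := tendsto_tsum_mul_cexp (fun n => n ^ 2) (fun _ => 1) (by simp) (fun n => sq_nonneg n)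
    sq_add_self_le_or
  rw [tsum_eq_single 0 (fun n hn => by simp [hn])] at h
  refine (h.congr fun τ => tsum_congr fun n => ?_).trans (by simp)
  rw [jacobiTheta₂_term]
  push_cast
  ring_nf

theorem tendsto_thetaFour : Tendsto thetaFour imAtTop (𝓝 1) := by
  have h := tendsto_tsum_mul_cexp (fun n => n ^ 2) (fun n => Complex.exp ((π * n : ℝ) * Complex.I))
    (fun n => Complex.norm_exp_ofReal_mul_I _) (fun n => sq_nonneg n) sq_add_self_le_or
  rw [tsum_eq_single 0 (fun n hn => by simp [hn])] at h
  refine (h.congr fun τ => tsum_congr fun n => ?_).trans (by simp)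
  rw [jacobiTheta₂_term, ← Complex.exp_add]
  push_cast
  ring_nf

theorem tendsto_jacobiTheta₂_half : Tendsto (fun τ => jacobiTheta₂ (τ / 2) τ) imAtTop (𝓝 2) := by
  have h := tendsto_tsum_mul_cexp (fun n => n ^ 2 + n) (fun _ => 1) (by simp)
    (fun n => by
      rcases le_or_gt 0 n with h | h
      · positivity
      · nlinarith) (fun n => Or.inl le_rfl)
  rw [tsum_eq_sum (s := {0, -1}) (fun n hn => by
    rw [if_neg]
    intro h0
    have h1 : n * (n + 1) = 0 := by rw [← h0]; ring
    simp only [Finset.mem_insert, Finset.mem_singleton, not_or] at hn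
    rcases mul_eq_zero.1 h1 with h2 | h2
    · exact hn.1 h2
    · exact hn.2 (by linarith))] at h
  refine (h.congr fun τ => tsum_congr fun n => ?_).trans
    (by rw [Finset.sum_pair (by norm_num)]; norm_num)
  rw [jacobiTheta₂_term]
  push_cast
  ring_nf

theorem tendsto_cexp_mul_imAtTop {c : ℝ} (hc : 0 < c) :
    Tendsto (fun τ : ℂ => Complex.exp (c * Complex.I * τ)) imAtTop (𝓝 0) := by
  rw [tendsto_zero_iff_norm_tendsto_zero]
  simp only [Complex.norm_exp]
  refine Real.tendsto_exp_atBot.comp ?_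
  refine ((tendsto_comap (f := Complex.im)).const_mul_atTop_of_neg (neg_lt_zero.2 hc)).congr
    fun τ => ?_
  simp

theorem tendsto_thetaTwo : Tendsto thetaTwo imAtTop (𝓝 0) := by
  have h := (tendsto_cexp_mul_imAtTop (c := π / 4) (by positivity)).mul tendsto_jacobiTheta₂_half
  rw [zero_mul] at h
  refine h.congr fun τ => ?_
  rw [thetaTwo]
  push_cast
  ring_nf

/-! ### Theta identities from level one cusp forms of weights 4 and 12. -/

section

open scoped MatrixGroups ModularForm

/-- A function on the upper half plane with the transformation behaviour of a level one modular
form, tending to zero at `i∞`, is a cusp form. -/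
theorem exists_cuspForm_of_transform (f : ℂ → ℂ) (k : ℕ)
    (hd : ∀ τ : ℂ, 0 < τ.im → DifferentiableAt ℂ f τ)
    (hT : ∀ τ : ℂ, 0 < τ.im → f (τ + 1) = f τ)
    (hS : ∀ τ : ℂ, 0 < τ.im → f (-1 / τ) = τ ^ k * f τ) (h0 : Tendsto f imAtTop (𝓝 0)) :
    ∃ g : CuspForm 𝒮ℒ (k : ℤ), ∀ τ : ℍ, g τ = f τ := by
  have hT' : ((fun τ : ℍ => f τ) ∣[(k : ℤ)] ModularGroup.T) = fun τ : ℍ => f τ := by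
    ext z
    have hden : denom (ModularGroup.T : GL (Fin 2) ℝ) z = 1 := by
      simp [denom, ModularGroup.coe_T]
    rw [ModularForm.SL_slash_apply, modular_T_smul]
    erw [hden]
    simpa [add_comm] using hT z z.im_pos
  have hS' : ((fun τ : ℍ => f τ) ∣[(k : ℤ)] ModularGroup.S) = fun τ : ℍ => f τ := by
    ext z
    have h := hS z z.im_pos
    rw [neg_div, one_div] at h
    have h1 : ((z : ℂ)) ^ k ≠ 0 := pow_ne_zero _ z.ne_zero
    rw [ModularForm.SL_slash_apply, UpperHalfPlane.modular_S_smul, ModularGroup.denom_S]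
    simp only [zpow_neg, zpow_natCast, inv_neg]
    rw [h]
    field_simp
  refine ⟨{ toFun := fun τ => f τ, slash_action_eq' := ?_, holo' := ?_, zero_at_cusps' := ?_},
    fun _ => rfl⟩
  · rintro _ ⟨A, rfl⟩
    exact SlashInvariantForm.slash_action_generators_SL2Z hS' hT' A
  · rw [UpperHalfPlane.mdifferentiable_iff]
    refine .congr (fun z hz => (hd z hz).differentiableWithinAt) fun z hz => ?_
    simp [ofComplex_apply_of_im_pos hz]
  -- Every cusp is carried to i∞ by SL₂(ℤ), and the function is invariant under the slash action, so
  -- the limit at i∞ suffices.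
  · intro c hc
    rw [Subgroup.IsArithmetic.isCusp_iff_isCusp_SL2Z] at hc
    rw [OnePoint.isZeroAt_iff_forall_SL2Z hc]
    intro γ _
    rw [SlashInvariantForm.slash_action_generators_SL2Z hS' hT']
    exact h0.comp (tendsto_comap_iff.2 tendsto_comap)

theorem cexp_pi_mul_I_div_four_pow_four : Complex.exp (π * Complex.I / 4) ^ 4 = -1 := by
  rw [← Complex.exp_nat_mul, ← Complex.exp_pi_mul_I]
  congr 1
  push_cast
  ring

/-- Jacobi's identity. -/
theorem thetaThree_pow_four {τ : ℂ} (hτ : 0 < τ.im) :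
    thetaThree τ ^ 4 = thetaTwo τ ^ 4 + thetaFour τ ^ 4 := by
  -- The defect θ₃⁴ - θ₄⁴ - θ₂⁴ changes sign under translation, and is multiplied by -τ² under
  -- inversion. Its square is therefore a level one cusp form of weight 4, hence zero.
  set f : ℂ → ℂ := fun τ => (thetaThree τ ^ 4 - thetaFour τ ^ 4 - thetaTwo τ ^ 4) ^ 2 with hf
  obtain ⟨g, hg⟩ := exists_cuspForm_of_transform f 4
    (fun τ hτ => ((((differentiableAt_thetaThree hτ).pow 4).sub
      ((differentiableAt_thetaFour hτ).pow 4)).sub ((differentiableAt_thetaTwo hτ).pow 4)).pow 2)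
    (fun τ _ => by
      simp only [hf, thetaThree_add_one, thetaFour_add_one, thetaTwo_add_one, mul_pow,
        cexp_pi_mul_I_div_four_pow_four]
      ring)
    (fun τ hτ => by
      have e : ∀ x : ℂ, x ^ 4 = (x ^ 2) ^ 2 := fun x => by ring
      simp only [hf]
      rw [e (thetaThree _), e (thetaFour _), e (thetaTwo _), thetaThree_neg_one_div hτ,
        thetaFour_neg_one_div hτ, thetaTwo_neg_one_div hτ]
      simp only [mul_pow, neg_sq, Complex.I_sq]
      ring)
    (by
      have := (((tendsto_thetaThree.pow 4).sub (tendsto_thetaFour.pow 4)).sub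
        (tendsto_thetaTwo.pow 4)).pow 2
      simpa using this)
  have h1 := (rank_zero_iff_forall_zero.1
    (CuspForm.rank_eq_zero_of_weight_lt_twelve (k := ((4 : ℕ) : ℤ)) (by norm_num))) g
  have h2 := hg ⟨τ, hτ⟩
  rw [h1] at h2
  have h3 : f τ = 0 := h2.symm
  have h4 := pow_eq_zero_iff (two_ne_zero) |>.1 h3
  linear_combination h4

/-- The left side is a cusp form of weight 12, hence a multiple of Δ = η²⁴; leading terms at i∞ fix
the constant 2⁸. -/
theorem theta_mul_pow_eight {τ : ℂ} (hτ : 0 < τ.im) :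
    (thetaTwo τ * thetaThree τ * thetaFour τ) ^ 8 = 256 * ModularForm.eta τ ^ 24 := by
  set f : ℂ → ℂ := fun τ => (thetaTwo τ * thetaThree τ * thetaFour τ) ^ 8 with hf
  obtain ⟨g, hg⟩ := exists_cuspForm_of_transform f 12
    (fun τ hτ => (((differentiableAt_thetaTwo hτ).mul (differentiableAt_thetaThree hτ)).mul
      (differentiableAt_thetaFour hτ)).pow 8)
    (fun τ _ => by
      have e : Complex.exp (π * Complex.I / 4) ^ 8 = 1 := by
        rw [show 8 = 4 * 2 by norm_num, pow_mul, cexp_pi_mul_I_div_four_pow_four]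
        norm_num
      simp only [hf, thetaThree_add_one, thetaFour_add_one, thetaTwo_add_one, mul_pow, e]
      ring)
    (fun τ hτ => by
      have e : ∀ x y z : ℂ, (x * y * z) ^ 8 = (x ^ 2 * y ^ 2 * z ^ 2) ^ 4 :=
        fun x y z => by ring
      have e12 : Complex.I ^ 12 = 1 := by
        rw [show 12 = 4 * 3 by norm_num, pow_mul, Complex.I_pow_four, one_pow]
      simp only [hf]
      rw [e, thetaThree_neg_one_div hτ, thetaFour_neg_one_div hτ, thetaTwo_neg_one_div hτ]
      linear_combination τ ^ 12 * (thetaTwo τ * thetaThree τ * thetaFour τ) ^ 8 * e12)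
    (by
      have := ((tendsto_thetaTwo.mul tendsto_thetaThree).mul tendsto_thetaFour).pow 8
      simpa using this)
  obtain ⟨c, hc⟩ := CuspForm.exists_smul_discriminant_of_weight_eq_twelve g
  have h1 : ∀ z : ℍ, f z = c * ModularForm.discriminant z := fun z => by
    rw [← hg z, ← hc]
    rfl
  have hcoe : Tendsto (fun z : ℍ => (z : ℂ)) atImInfty imAtTop :=
    tendsto_comap_iff.2 tendsto_comap
  -- Cancelling the factor q = e^(2πiz) carried by both θ₂⁸ and Δ leaves finite limits at i∞, namely
  -- 2⁸ and c.
  have h2 : ∀ z : ℍ, (jacobiTheta₂ ((z : ℂ) / 2) z * thetaThree z * thetaFour z) ^ 8 =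
      c * ∏' n, (1 - ModularForm.eta_q n z) ^ 24 := by
    intro z
    have h := h1 z
    rw [ModularForm.discriminant_eq_q_prod] at h
    have hq : Complex.exp (π * Complex.I * z / 4) ^ 8 = Function.Periodic.qParam 1 z := by
      rw [← Complex.exp_nat_mul, Function.Periodic.qParam]
      congr 1
      push_cast
      ring
    have hq0 : Function.Periodic.qParam 1 z ≠ 0 := Complex.exp_ne_zero _
    simp only [hf, thetaTwo] at h
    refine mul_left_cancel₀ hq0 ?_
    rw [← hq] at h ⊢
    linear_combination h
  have h3 := ((tendsto_jacobiTheta₂_half.mul tendsto_thetaThree).mul tendsto_thetaFour).pow 8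
  have h4 := (h3.comp hcoe).congr h2
  have h5 := tendsto_nhds_unique h4
    (ModularForm.tendsto_atImInfty_tprod_one_sub_eta_q_pow.const_mul c)
  have h6 := h1 ⟨τ, hτ⟩
  have h7 : c = 256 := by rw [← mul_one c, ← h5]; norm_num
  rw [h7] at h6
  exact h6

end

/-! ### Doubling formulas -/

theorem summable_norm_cexp_pi_mul_I_mul_sq {τ : ℂ} (hτ : 0 < τ.im) :
    Summable fun n : ℤ => ‖Complex.exp (π * Complex.I * n ^ 2 * τ)‖ := by
  refine (hasSum_jacobiTheta₂_term 0 hτ).summable.norm.congr fun n => ?_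
  rw [jacobiTheta₂_term]
  simp

/-- The sign `(-1) ^ n`. -/
def intSign (n : ℤ) : ℂ := Complex.exp (π * Complex.I * n)

theorem intSign_add (m n : ℤ) : intSign (m + n) = intSign m * intSign n := by
  rw [intSign, intSign, intSign, ← Complex.exp_add]
  push_cast
  ring_nf

theorem intSign_two_mul (n : ℤ) : intSign (2 * n) = 1 := by
  rw [intSign, ← Complex.exp_int_mul_two_pi_mul_I n]
  push_cast
  ring_nf

theorem intSign_one : intSign 1 = -1 := by
  simp [intSign]

theorem norm_intSign (n : ℤ) : ‖intSign n‖ = 1 := by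
  rw [intSign, show (π : ℂ) * Complex.I * n = ((π * n : ℝ) : ℂ) * Complex.I by push_cast; ring,
    Complex.norm_exp_ofReal_mul_I]

theorem thetaThree_eq_tsum (τ : ℂ) :
    thetaThree τ = ∑' n : ℤ, Complex.exp (π * Complex.I * n ^ 2 * τ) := by
  refine tsum_congr fun n => ?_
  rw [jacobiTheta₂_term]
  simp

theorem thetaFour_eq_tsum (τ : ℂ) :
    thetaFour τ = ∑' n : ℤ, intSign n * Complex.exp (π * Complex.I * n ^ 2 * τ) := by
  refine tsum_congr fun n => ?_
  rw [jacobiTheta₂_term, intSign, ← Complex.exp_add]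
  ring_nf

theorem tsum_eq_tsum_add_sub {F : ℤ × ℤ → ℂ} (hF : ∀ m n : ℤ, Odd (m + n) → F (m, n) = 0) :
    ∑' p, F p = ∑' p : ℤ × ℤ, F (p.1 + p.2, p.1 - p.2) := by
  refine (Function.Injective.tsum_eq (g := fun p : ℤ × ℤ => (p.1 + p.2, p.1 - p.2)) ?_ ?_).symm
  · rintro ⟨a, b⟩ ⟨c, d⟩ h
    simp only [Prod.mk.injEq] at h ⊢
    omega
  · rintro ⟨m, n⟩ h
    rcases Int.even_or_odd (m + n) with ⟨k, hk⟩ | h2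
    · exact ⟨(k, m - k), by simp only [Prod.mk.injEq]; omega⟩
    · exact absurd (hF m n h2) h

/-- In the double sums, pairs (m, n) with m + n odd cancel. The others are (a+b, a-b), and (a+b)² +
(a-b)² = 2a² + 2b² doubles τ. -/
theorem thetaThree_sq_add_thetaFour_sq {τ : ℂ} (hτ : 0 < τ.im) :
    thetaThree τ ^ 2 + thetaFour τ ^ 2 = 2 * thetaThree (2 * τ) ^ 2 := by
  have hτ2 : 0 < (2 * τ).im := by simpa using hτ
  set e : ℂ → ℤ → ℂ := fun τ n => Complex.exp (π * Complex.I * n ^ 2 * τ) with he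
  have hs := summable_norm_cexp_pi_mul_I_mul_sq hτ
  have hs2 := summable_norm_cexp_pi_mul_I_mul_sq hτ2
  have hs' : Summable fun n : ℤ => ‖intSign n * e τ n‖ := by
    simpa only [norm_mul, norm_intSign, one_mul] using hs
  rw [sq, sq, sq, thetaThree_eq_tsum, thetaThree_eq_tsum, thetaFour_eq_tsum,
    tsum_mul_tsum_of_summable_norm hs hs, tsum_mul_tsum_of_summable_norm hs2 hs2,
    tsum_mul_tsum_of_summable_norm hs' hs', ← Summable.tsum_add
      (summable_mul_of_summable_norm hs hs) (summable_mul_of_summable_norm hs' hs'),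
    tsum_eq_tsum_add_sub, ← tsum_mul_left]
  · refine tsum_congr fun p => ?_
    have h1 : intSign (p.1 + p.2) * intSign (p.1 - p.2) = 1 := by
      rw [← intSign_add, ← intSign_two_mul p.1]
      ring_nf
    have h2 : e τ (p.1 + p.2) * e τ (p.1 - p.2) = e (2 * τ) p.1 * e (2 * τ) p.2 := by
      simp only [he, ← Complex.exp_add]
      push_cast
      ring_nf
    linear_combination 2 * h2 + (e τ (p.1 + p.2) * e τ (p.1 - p.2)) * h1
  · intro m n ⟨k, hk⟩
    have h1 : intSign m * intSign n = -1 := by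
      rw [← intSign_add, hk, intSign_add, intSign_two_mul, intSign_one, one_mul]
    linear_combination h1 * (e τ m * e τ n)

theorem thetaThree_mul_thetaFour {τ : ℂ} (hτ : 0 < τ.im) :
    thetaThree τ * thetaFour τ = thetaFour (2 * τ) ^ 2 := by
  have hτ2 : 0 < (2 * τ).im := by simpa using hτ
  set e : ℂ → ℤ → ℂ := fun τ n => Complex.exp (π * Complex.I * n ^ 2 * τ) with he
  have hs := summable_norm_cexp_pi_mul_I_mul_sq hτ
  have hs' : ∀ {τ : ℂ}, 0 < τ.im → Summable fun n : ℤ => ‖intSign n * e τ n‖ := by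
    intro τ hτ
    simpa only [norm_mul, norm_intSign, one_mul] using summable_norm_cexp_pi_mul_I_mul_sq hτ
  -- Symmetrising the product replaces the sign (-1)ⁿ by (-1)ᵐ + (-1)ⁿ, which vanishes when m + n is
  -- odd.
  have h2 : 2 * (thetaThree τ * thetaFour τ) = 2 * thetaFour (2 * τ) ^ 2 := by
    rw [two_mul]
    nth_rewrite 2 [mul_comm]
    rw [sq, thetaThree_eq_tsum, thetaFour_eq_tsum, thetaFour_eq_tsum,
      tsum_mul_tsum_of_summable_norm hs (hs' hτ), tsum_mul_tsum_of_summable_norm (hs' hτ) hs,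
      tsum_mul_tsum_of_summable_norm (hs' hτ2) (hs' hτ2), ← Summable.tsum_add
        (summable_mul_of_summable_norm hs (hs' hτ)) (summable_mul_of_summable_norm (hs' hτ) hs),
      tsum_eq_tsum_add_sub, ← tsum_mul_left]
    · refine tsum_congr fun p => ?_
      have h1 : intSign (p.1 - p.2) = intSign (p.1 + p.2) := by
        rw [show p.1 + p.2 = (p.1 - p.2) + 2 * p.2 by ring, intSign_add _ (2 * p.2),
          intSign_two_mul, mul_one]
      have h2 : e τ (p.1 + p.2) * e τ (p.1 - p.2) = e (2 * τ) p.1 * e (2 * τ) p.2 := by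
        simp only [he, ← Complex.exp_add]
        push_cast
        ring_nf
      have h3 := intSign_add p.1 p.2
      linear_combination 2 * intSign (p.1 + p.2) * h2 + e τ (p.1 + p.2) * e τ (p.1 - p.2) * h1
        + 2 * e (2 * τ) p.1 * e (2 * τ) p.2 * h3
    · intro m n ⟨k, hk⟩
      have h1 : intSign m + intSign n = 0 := by
        rw [show n = 2 * (k - m) + m + 1 by linarith, intSign_add, intSign_add, intSign_two_mul,
          intSign_one]
        ring
      linear_combination h1 * (e τ m * e τ n)
  exact mul_left_cancel₀ two_ne_zero h2

/-! ### Theta constants on the imaginary axis -/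

/-- The square of `θ₃` on the imaginary axis. -/
def thetaA (y : ℝ) : ℝ := (thetaThree (Complex.I * y)).re ^ 2

/-- The square of `θ₄` on the imaginary axis. -/
def thetaB (y : ℝ) : ℝ := (thetaFour (Complex.I * y)).re ^ 2

theorem neg_conj_I_mul (y : ℝ) :
    -(starRingEnd ℂ) (Complex.I * y) = Complex.I * y := by
  simp

theorem ofReal_re_thetaThree (y : ℝ) :
    ((thetaThree (Complex.I * y)).re : ℂ) = thetaThree (Complex.I * y) := by
  rw [← Complex.conj_eq_iff_re, thetaThree, jacobiTheta₂_conj, neg_conj_I_mul, map_zero]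

theorem ofReal_re_thetaFour (y : ℝ) :
    ((thetaFour (Complex.I * y)).re : ℂ) = thetaFour (Complex.I * y) := by
  rw [← Complex.conj_eq_iff_re, thetaFour, jacobiTheta₂_conj, neg_conj_I_mul, map_div₀, map_one,
    Complex.conj_ofNat]

theorem ofReal_thetaA (y : ℝ) : (thetaA y : ℂ) = thetaThree (Complex.I * y) ^ 2 := by
  rw [thetaA, Complex.ofReal_pow, ofReal_re_thetaThree]

theorem ofReal_thetaB (y : ℝ) : (thetaB y : ℂ) = thetaFour (Complex.I * y) ^ 2 := by
  rw [thetaB, Complex.ofReal_pow, ofReal_re_thetaFour]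

theorem neg_one_div_I_mul {y : ℝ} (hy : 0 < y) :
    -1 / (Complex.I * y) = Complex.I * (1 / y : ℝ) := by
  have hy' : (y : ℂ) ≠ 0 := by exact_mod_cast hy.ne'
  push_cast
  field_simp
  rw [Complex.I_sq]

theorem theta_ne_zero {τ : ℂ} (hτ : 0 < τ.im) :
    thetaThree τ ≠ 0 ∧ thetaFour τ ≠ 0 := by
  have h := theta_mul_pow_eight hτ
  have h2 : (thetaTwo τ * thetaThree τ * thetaFour τ) ^ 8 ≠ 0 := by
    rw [h]
    exact mul_ne_zero (by norm_num) (pow_ne_zero _ (ModularForm.eta_ne_zero hτ))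
  constructor <;> intro h0 <;> simp [h0] at h2

theorem thetaA_pos {y : ℝ} (hy : 0 < y) : 0 < thetaA y := by
  have h := (theta_ne_zero (τ := Complex.I * y) (by simpa using hy)).1
  rw [← ofReal_re_thetaThree] at h
  exact sq_pos_of_ne_zero (by exact_mod_cast h)

theorem thetaB_pos {y : ℝ} (hy : 0 < y) : 0 < thetaB y := by
  have h := (theta_ne_zero (τ := Complex.I * y) (by simpa using hy)).2
  rw [← ofReal_re_thetaFour] at h
  exact sq_pos_of_ne_zero (by exact_mod_cast h)

theorem thetaA_one_div {y : ℝ} (hy : 0 < y) : thetaA (1 / y) = y * thetaA y := by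
  have h := thetaThree_neg_one_div (τ := Complex.I * y) (by simpa using hy)
  rw [neg_one_div_I_mul hy, ← ofReal_thetaA, ← ofReal_thetaA, ← mul_assoc, neg_mul,
    Complex.I_mul_I, neg_neg, one_mul] at h
  exact_mod_cast h

theorem ofReal_thetaB_one_div {y : ℝ} (hy : 0 < y) :
    (thetaB (1 / y) : ℂ) = y * thetaTwo (Complex.I * y) ^ 2 := by
  have h := thetaFour_neg_one_div (τ := Complex.I * y) (by simpa using hy)
  rw [neg_one_div_I_mul hy, ← ofReal_thetaB, ← mul_assoc, neg_mul,
    Complex.I_mul_I, neg_neg, one_mul] at h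
  exact h

/-- Jacobi's identity with θ₂ at iy replaced by θ₄ at i/y, so that only `thetaA` and `thetaB` are
needed. -/
theorem thetaA_sq {y : ℝ} (hy : 0 < y) :
    y ^ 2 * thetaA y ^ 2 = y ^ 2 * thetaB y ^ 2 + thetaB (1 / y) ^ 2 := by
  have h := thetaThree_pow_four (τ := Complex.I * y) (by simpa using hy)
  have h2 := ofReal_thetaB_one_div hy
  have h3 : ((y ^ 2 * thetaA y ^ 2 : ℝ) : ℂ) = (y ^ 2 * thetaB y ^ 2 + thetaB (1 / y) ^ 2 : ℝ) := by
    push_cast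
    rw [ofReal_thetaA, ofReal_thetaB, h2]
    linear_combination (y : ℂ) ^ 2 * h
  exact_mod_cast h3

theorem I_mul_two_mul (y : ℝ) : Complex.I * ((2 * y : ℝ) : ℂ) = 2 * (Complex.I * y) := by
  push_cast; ring

theorem thetaA_two_mul {y : ℝ} (hy : 0 < y) : thetaA (2 * y) = (thetaA y + thetaB y) / 2 := by
  have h := thetaThree_sq_add_thetaFour_sq (τ := Complex.I * y) (by simpa using hy)
  rw [← I_mul_two_mul, ← ofReal_thetaA, ← ofReal_thetaA, ← ofReal_thetaB] at h
  have h2 : thetaA y + thetaB y = 2 * thetaA (2 * y) := by exact_mod_cast h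
  linarith

/-- With `thetaA_two_mul`: doubling y is one step of the arithmetic-geometric mean on (θ₃², θ₄²). -/
theorem thetaB_two_mul_sq {y : ℝ} (hy : 0 < y) : thetaB (2 * y) ^ 2 = thetaA y * thetaB y := by
  have h := thetaThree_mul_thetaFour (τ := Complex.I * y) (by simpa using hy)
  have h2 : ((thetaB (2 * y) ^ 2 : ℝ) : ℂ) = (thetaA y * thetaB y : ℝ) := by
    push_cast
    rw [ofReal_thetaA, ofReal_thetaB, ofReal_thetaB, I_mul_two_mul, ← h]
    ring
  exact_mod_cast h2

theorem tendsto_I_mul_imAtTop : Tendsto (fun y : ℝ => Complex.I * (y : ℂ)) atTop imAtTop :=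
  tendsto_comap_iff.2 (tendsto_id.congr fun y => by simp)

theorem tendsto_thetaA : Tendsto thetaA atTop (𝓝 1) := by
  have h := ((Complex.continuous_re.tendsto 1).comp
    (tendsto_thetaThree.comp tendsto_I_mul_imAtTop)).pow 2
  simpa using! h

theorem tendsto_thetaB : Tendsto thetaB atTop (𝓝 1) := by
  have h := ((Complex.continuous_re.tendsto 1).comp
    (tendsto_thetaFour.comp tendsto_I_mul_imAtTop)).pow 2
  simpa using! h

theorem thetaB_lt_thetaA {y : ℝ} (hy : 0 < y) : thetaB y < thetaA y := by
  have h := thetaA_sq hy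
  have h1 := thetaB_pos (one_div_pos.2 hy)
  have h2 : 0 < y ^ 2 * (thetaA y ^ 2 - thetaB y ^ 2) := by nlinarith
  have h3 := (pos_iff_pos_of_mul_pos h2).1 (by positivity)
  exact lt_of_pow_lt_pow_left₀ 2 (thetaA_pos hy).le (by linarith)

theorem conj_eta_I_mul (y : ℝ) (hy : 0 < y) :
    (starRingEnd ℂ) (ModularForm.eta (Complex.I * y)) = ModularForm.eta (Complex.I * y) := by
  have hexp : ∀ c : ℝ, (starRingEnd ℂ) (Complex.exp (2 * π * Complex.I * (Complex.I * y) * c)) =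
      Complex.exp (2 * π * Complex.I * (Complex.I * y) * c) := by
    intro c
    rw [← Complex.exp_conj]
    simp [Complex.conj_ofNat]
  have hq : (starRingEnd ℂ) (Function.Periodic.qParam 24 (Complex.I * y)) =
      Function.Periodic.qParam 24 (Complex.I * y) := by
    have := hexp (1 / 24)
    simpa [Function.Periodic.qParam, div_eq_mul_inv] using this
  have hm := ModularForm.multipliableLocallyUniformlyOn_eta.multipliable
    (x := Complex.I * y) (by simpa [UpperHalfPlane.upperHalfPlaneSet] using hy)
  rw [ModularForm.eta, map_mul, hq, hm.map_tprod (starRingEnd ℂ) Complex.continuous_conj]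
  congr 1
  refine tprod_congr fun n => ?_
  have := hexp (n + 1)
  rw [ModularForm.eta_q_eq_pow, map_sub, map_one, map_pow]
  have h1 := hexp 1
  simp only [Complex.ofReal_one, mul_one] at h1
  rw [h1]

/-- The theta product determines only η²⁴. Since η(iy) is real, η¹² is nonnegative there, which
selects the square root. -/
theorem etaPow_I_mul {y : ℝ} (hy : 0 < y) :
    etaPow (Complex.I * y) = ((thetaA y * thetaB y * (thetaB (1 / y) / y)) ^ 2 / 16 : ℝ) := by
  set P := (thetaA y * thetaB y * (thetaB (1 / y) / y)) ^ 2 / 16 with hP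
  have h1 := Complex.conj_eq_iff_re.1 (conj_eta_I_mul y hy)
  set r := (ModularForm.eta (Complex.I * y)).re with hr
  have h2 := theta_mul_pow_eight (τ := Complex.I * y) (by simpa using hy)
  have hy' : (y : ℂ) ≠ 0 := by exact_mod_cast hy.ne'
  have h3 : ((P ^ 2 : ℝ) : ℂ) = ((r ^ 12) ^ 2 : ℝ) := by
    rw [hP, ← pow_mul, Complex.ofReal_pow r, h1]
    have h4 := ofReal_thetaB_one_div hy
    push_cast at h4 ⊢
    rw [ofReal_thetaA, ofReal_thetaB, h4]
    field_simp
    linear_combination h2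
  have h4 : P ^ 2 = (r ^ 12) ^ 2 := by exact_mod_cast h3
  have h5 : P = r ^ 12 := by
    refine (pow_left_inj₀ ?_ ?_ two_ne_zero).1 h4
    · positivity
    · rw [show 12 = 2 * 6 by norm_num, pow_mul]; positivity
  rw [etaPow, ← h1, h5]
  push_cast
  rfl

/-! ### Landen's transformation and the inverse of the modular lambda function -/

theorem eq_of_hasDerivAt_zero_Ico {f : ℝ → ℝ} (hf : ∀ x ∈ Ico (0 : ℝ) 1, HasDerivAt f 0 x) {x : ℝ}
    (hx : x ∈ Ico (0 : ℝ) 1) : f x = f 0 := by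
  refine constant_of_has_deriv_right_zero (a := 0) (b := x) (f := f) (fun t ht =>
    (hf t ⟨ht.1, ht.2.trans_lt hx.2⟩).continuousAt.continuousWithinAt) (fun t ht =>
    (hf t ⟨ht.1, ht.2.trans hx.2⟩).hasDerivWithinAt) x ⟨hx.1, le_rfl⟩

theorem landen_mem {x : ℝ} (hx : x ∈ Ico (0 : ℝ) 1) : |4 * x / (1 + x) ^ 2| < 1 := by
  obtain ⟨h0, h1⟩ := hx
  rw [abs_of_nonneg (by positivity), div_lt_one (by positivity)]
  nlinarith [sq_pos_of_pos (sub_pos.2 h1)]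

theorem ellG_zero : ellG 0 = 1 / 4 := by
  rw [ellG, tsum_eq_single 0 (fun n hn => by simp [hn])]
  simp [halfCoeff_zero]

/-- Landen's transformation. -/
theorem ellF_landen {x : ℝ} (hx : x ∈ Ico (0 : ℝ) 1) :
    ellF (4 * x / (1 + x) ^ 2) = (1 + x) * ellF (x ^ 2) := by
  set s : ℝ → ℝ := fun x => 4 * x / (1 + x) ^ 2 with hs
  have ds : ∀ x ∈ Ico (0 : ℝ) 1, HasDerivAt s (4 * (1 - x) / (1 + x) ^ 3) x := by
    intro x hx
    have h0 : 1 + x ≠ 0 := by linarith [hx.1]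
    have h := ((hasDerivAt_id' x).const_mul 4).fun_div (((hasDerivAt_id' x).const_add 1).fun_pow 2)
      (pow_ne_zero 2 h0)
    refine h.congr_deriv ?_
    field_simp
    ring
  have hsq : ∀ x ∈ Ico (0 : ℝ) 1, |x ^ 2| < 1 := fun x hx => by
    rw [abs_of_nonneg (sq_nonneg x)]
    nlinarith [hx.1, hx.2]
  have du : ∀ x ∈ Ico (0 : ℝ) 1,
      HasDerivAt (fun x => ellF (s x)) (4 * ellG (s x) / ((1 - x) * (1 + x))) x := by
    intro x hx
    have h0 : 1 + x ≠ 0 := by linarith [hx.1]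
    have h1 : 1 - x ≠ 0 := by linarith [hx.2]
    have h2 : 1 - s x = ((1 - x) / (1 + x)) ^ 2 := by
      simp only [hs]; field_simp; ring
    refine ((hasDerivAt_ellF (landen_mem hx)).comp x (ds x hx)).congr_deriv ?_
    change ellG (s x) / (1 - s x) * _ = _
    rw [h2]
    field_simp
  have dU : ∀ x ∈ Ico (0 : ℝ) 1, HasDerivAt (fun x => s x * ellG (s x))
      (ellF (s x) / 4 * (4 * (1 - x) / (1 + x) ^ 3)) x := fun x hx =>
    HasDerivAt.comp (h₂ := fun t => t * ellG t) (h := s) x (hasDerivAt_mul_ellG (landen_mem hx))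
      (ds x hx)
  have dF : ∀ x ∈ Ico (0 : ℝ) 1, HasDerivAt (fun x => ellF (x ^ 2))
      (ellG (x ^ 2) / (1 - x ^ 2) * (2 * x)) x := fun x hx => by
    refine (HasDerivAt.comp (h₂ := ellF) (h := fun x => x ^ 2) x (hasDerivAt_ellF (hsq x hx))
      (hasDerivAt_pow 2 x)).congr_deriv ?_
    simp
  have dH : ∀ x ∈ Ico (0 : ℝ) 1, HasDerivAt (fun x => x ^ 2 * ellG (x ^ 2))
      (ellF (x ^ 2) / 4 * (2 * x)) x := fun x hx => by
    refine (HasDerivAt.comp (h₂ := fun t => t * ellG t) (h := fun x => x ^ 2) x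
      (hasDerivAt_mul_ellG (hsq x hx)) (hasDerivAt_pow 2 x)).congr_deriv ?_
    simp
  have dv : ∀ x ∈ Ico (0 : ℝ) 1, HasDerivAt (fun x => (1 + x) * ellF (x ^ 2))
      (ellF (x ^ 2) + 2 * x * ellG (x ^ 2) / (1 - x)) x := by
    intro x hx
    have h0 : 1 + x ≠ 0 := by linarith [hx.1]
    have h1 : 1 - x ≠ 0 := by linarith [hx.2]
    refine (((hasDerivAt_id x).const_add 1).mul (dF x hx)).congr_deriv ?_
    simp only [id]
    rw [show 1 - x ^ 2 = (1 - x) * (1 + x) by ring]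
    field_simp
  have dV : ∀ x ∈ Ico (0 : ℝ) 1,
      HasDerivAt (fun x => (x * (1 - x) * ellF (x ^ 2) + 2 * (x ^ 2 * ellG (x ^ 2))) / (1 + x))
      ((1 - x) * ellF (x ^ 2) / (1 + x) ^ 2) x := by
    intro x hx
    have h0 : 1 + x ≠ 0 := by linarith [hx.1]
    have h1 : 1 - x ≠ 0 := by linarith [hx.2]
    have hx1 : HasDerivAt (fun x : ℝ => x * (1 - x)) (1 - 2 * x) x := by
      refine ((hasDerivAt_id x).mul ((hasDerivAt_id x).const_sub 1)).congr_deriv ?_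
      simp only [id]
      ring
    refine (((hx1.mul (dF x hx)).add ((dH x hx).const_mul 2)).div ((hasDerivAt_id x).const_add 1)
      h0).congr_deriv ?_
    simp only [id, Pi.mul_apply, Pi.add_apply]
    rw [show 1 - x ^ 2 = (1 - x) * (1 + x) by ring]
    field_simp
    ring
  -- Put u = F(s), v = (1+x)F(x²), U = sG(s), and let V be the function differentiated in `dV`. Away
  -- from 0, (u, U) and (v, V) solve one linear system, u' = (1+x)/(x(1-x)) U and U' = (1-x)/(1+x)³
  -- u. Hence uV - vU is constant, and it vanishes at 0.
  have hD : ∀ x ∈ Ico (0 : ℝ) 1,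
      ellF (s x) * ((x * (1 - x) * ellF (x ^ 2) + 2 * (x ^ 2 * ellG (x ^ 2))) / (1 + x)) -
        (1 + x) * ellF (x ^ 2) * (s x * ellG (s x)) = 0 := by
    intro x hx
    have h := eq_of_hasDerivAt_zero_Ico (f := fun x =>
      ellF (s x) * ((x * (1 - x) * ellF (x ^ 2) + 2 * (x ^ 2 * ellG (x ^ 2))) / (1 + x)) -
        (1 + x) * ellF (x ^ 2) * (s x * ellG (s x))) (fun x hx => by
      have h0 : 1 + x ≠ 0 := by linarith [hx.1]
      have h1 : 1 - x ≠ 0 := by linarith [hx.2]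
      refine (((du x hx).mul (dV x hx)).sub ((dv x hx).mul (dU x hx))).congr_deriv ?_
      have e : s x = 4 * x / (1 + x) ^ 2 := rfl
      generalize ellF (s x) = a
      generalize ellG (s x) = b
      generalize ellF (x ^ 2) = c
      generalize ellG (x ^ 2) = d
      rw [e]
      field_simp
      ring) hx
    simpa [hs] using h
  -- The vanishing of uV - vU says u'v = uv', so u/v keeps its value 1 at x = 0.
  have hquot := eq_of_hasDerivAt_zero_Ico (f := fun x => ellF (s x) / ((1 + x) * ellF (x ^ 2)))
    (fun x hx => by
      have h0 : 1 + x ≠ 0 := by linarith [hx.1]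
      have h1 : 1 - x ≠ 0 := by linarith [hx.2]
      have hpos : ellF (x ^ 2) ≠ 0 :=
        (ellF_pos (sq_nonneg x) (by nlinarith [hx.1, hx.2])).ne'
      refine ((du x hx).div (dv x hx) (mul_ne_zero h0 hpos)).congr_deriv ?_
      have h := hD x hx
      have e : s x = 4 * x / (1 + x) ^ 2 := rfl
      rw [div_eq_zero_iff]
      left
      -- The relation `hD` carries a factor x, so it says nothing at x = 0.
      rcases eq_or_ne x 0 with rfl | hx0
      · simp [hs, ellF_zero, ellG_zero]
      · generalize ellF (s x) = a at *
        generalize ellG (s x) = b at *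
        generalize ellF (x ^ 2) = c at *
        generalize ellG (x ^ 2) = d at *
        rw [e] at h
        field_simp at h ⊢
        have h' : a * ((1 - x) * c + x * 2 * d) - c * 4 * b = 0 :=
          mul_left_cancel₀ hx0 (by linear_combination h)
        linear_combination -h') hx
  have hpos : ellF (x ^ 2) ≠ 0 := (ellF_pos (sq_nonneg x) (by nlinarith [hx.1, hx.2])).ne'
  have h0 : 1 + x ≠ 0 := by linarith [hx.1]
  have e0 : s 0 = 0 := by simp [hs]
  simp only [e0, ne_eq, OfNat.ofNat_ne_zero, not_false_eq_true, zero_pow, add_zero, one_mul,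
    ellF_zero, div_one] at hquot
  rwa [div_eq_one_iff_eq (mul_ne_zero h0 hpos)] at hquot

theorem ellF_one_sub_sq {k : ℝ} (h0 : 0 < k) (h1 : k < 1) :
    ellF (1 - k ^ 2) = 2 / (1 + k) * ellF (((1 - k) / (1 + k)) ^ 2) := by
  have h := ellF_landen (x := (1 - k) / (1 + k))
    ⟨div_nonneg (by linarith) (by linarith), (div_lt_one (by linarith)).2 (by linarith)⟩
  have e1 : 1 + (1 - k) / (1 + k) = 2 / (1 + k) := by field_simp; ring
  rw [e1] at h
  rw [← h]
  congr 1
  field_simp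
  ring

/-- The modular lambda function on the imaginary axis. -/
def lambdaIm (y : ℝ) : ℝ := 1 - (thetaB y / thetaA y) ^ 2

theorem lambdaIm_mem {y : ℝ} (hy : 0 < y) : lambdaIm y ∈ Ioo (0 : ℝ) 1 := by
  have h1 := thetaB_pos hy
  have h2 := thetaA_pos hy
  have h3 : thetaB y / thetaA y < 1 := (div_lt_one h2).2 (thetaB_lt_thetaA hy)
  have h4 : 0 < thetaB y / thetaA y := by positivity
  constructor <;> rw [lambdaIm] <;> nlinarith

/-- With k = θ₄²/θ₃², doubling y replaces λ = 1 - k² by ((1-k)/(1+k))² and θ₃² by θ₃²(1+k)/2;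
Landen's transformation rescales F by the same factor. -/
theorem ellF_lambdaIm_two_mul {y : ℝ} (hy : 0 < y) :
    ellF (lambdaIm (2 * y)) / thetaA (2 * y) = ellF (lambdaIm y) / thetaA y := by
  have h1 := thetaB_pos hy
  have h2 := thetaA_pos hy
  have e : lambdaIm (2 * y) =
      ((1 - thetaB y / thetaA y) / (1 + thetaB y / thetaA y)) ^ 2 := by
    rw [lambdaIm, div_pow, thetaB_two_mul_sq hy, thetaA_two_mul hy]
    field_simp
    ring
  rw [e, lambdaIm, ellF_one_sub_sq (div_pos h1 h2) ((div_lt_one h2).2 (thetaB_lt_thetaA hy)),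
    thetaA_two_mul hy]
  field_simp

/-- The quotient is unchanged along 2ⁿy, and tends to F(0)/1 = 1 there. -/
theorem ellF_lambdaIm {y : ℝ} (hy : 0 < y) : ellF (lambdaIm y) = thetaA y := by
  have h1 : ∀ n : ℕ, ellF (lambdaIm (2 ^ n * y)) / thetaA (2 ^ n * y) =
      ellF (lambdaIm y) / thetaA y := by
    intro n
    induction n with
    | zero => simp
    | succ n ih =>
      rw [pow_succ', mul_assoc, ellF_lambdaIm_two_mul (by positivity), ih]
  have h2 : Tendsto (fun n : ℕ => (2 : ℝ) ^ n * y) atTop atTop :=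
    (tendsto_pow_atTop_atTop_of_one_lt one_lt_two).atTop_mul_const hy
  have h3 : Tendsto lambdaIm atTop (𝓝 0) := by
    have := ((tendsto_thetaB.div tendsto_thetaA one_ne_zero).pow 2).const_sub 1
    simpa using! this
  have h4 : Tendsto (fun y => ellF (lambdaIm y)) atTop (𝓝 1) := by
    have h := (hasDerivAt_ellF (t := 0) (by simp)).continuousAt.tendsto.comp h3
    rwa [ellF_zero] at h
  have h5 := (h4.div tendsto_thetaA one_ne_zero).comp h2
  have h6 := tendsto_nhds_unique (h5.congr h1) tendsto_const_nhds
  rw [div_one, eq_comm, div_eq_one_iff_eq (thetaA_pos hy).ne'] at h6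
  exact h6

theorem one_sub_lambdaIm {y : ℝ} (hy : 0 < y) : 1 - lambdaIm y = lambdaIm (1 / y) := by
  have h1 := thetaA_pos hy
  have h2 := thetaA_sq hy
  rw [lambdaIm, lambdaIm, thetaA_one_div hy]
  field_simp
  linarith

theorem ellF_one_sub_lambdaIm {y : ℝ} (hy : 0 < y) :
    ellF (1 - lambdaIm y) = y * thetaA y := by
  rw [one_sub_lambdaIm hy, ellF_lambdaIm (one_div_pos.2 hy), thetaA_one_div hy]

/-- The ratio of complementary periods, inverse to `lambdaIm`. -/
def ellRatio (t : ℝ) : ℝ := ellF (1 - t) / ellF t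

theorem ellRatio_lambdaIm {y : ℝ} (hy : 0 < y) : ellRatio (lambdaIm y) = y := by
  rw [ellRatio, ellF_one_sub_lambdaIm hy, ellF_lambdaIm hy, mul_div_cancel_right₀ _ (thetaA_pos hy).ne']

/-- Legendre's relation. -/
theorem ellG_legendre {t : ℝ} (ht : t ∈ Ioo (0 : ℝ) 1) :
    t * ellG t * ellF (1 - t) + ellF t * ((1 - t) * ellG (1 - t)) = 1 / π := by
  set L : ℝ → ℝ := fun t => t * ellG t * ellF (1 - t) + ellF t * ((1 - t) * ellG (1 - t)) with hL
  have hd : ∀ t ∈ Ioo (0 : ℝ) 1, HasDerivAt L 0 t := by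
    intro t ht
    have h0 : t ≠ 0 := ht.1.ne'
    have h1 : 1 - t ≠ 0 := by linarith [ht.2]
    refine (((hasDerivAt_mul_ellG (abs_lt_one_of_mem_Ioo ht)).mul (hasDerivAt_ellF_one_sub ht)).add
      ((hasDerivAt_ellF (abs_lt_one_of_mem_Ioo ht)).mul
        (hasDerivAt_one_sub_mul_ellG ht))).congr_deriv ?_
    field_simp
    ring
  have hc : ∀ s ∈ Ioo (0 : ℝ) 1, L s = L t := fun s hs =>
    isOpen_Ioo.is_const_of_deriv_eq_zero isPreconnected_Ioo
      (fun x hx => (hd x hx).differentiableAt.differentiableWithinAt) (fun x hx => (hd x hx).deriv)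
      hs ht
  -- The constant is read off at 0, where G(1 - t) tends to 1/π.
  have h1 : Tendsto L (𝓝[>] 0) (𝓝 (ellG 0 * 0 + 1 * ((1 - 0) * (1 / π)))) := by
    have hid : Tendsto (fun t : ℝ => 1 - t) (𝓝[>] 0) (𝓝 (1 - 0)) :=
      ((continuous_const.sub continuous_id).tendsto 0).mono_left nhdsWithin_le_nhds
    refine ((tendsto_ellG_zero.mul tendsto_mul_ellF_one_sub).add
      (tendsto_ellF_zero.mul (hid.mul tendsto_ellG_one_sub))).congr fun t => ?_
    simp only [hL]
    ring
  have h2 : Tendsto L (𝓝[>] 0) (𝓝 (L t)) := by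
    refine tendsto_const_nhds.congr' ?_
    filter_upwards [Ioo_mem_nhdsGT one_pos] with s hs
    exact (hc s hs).symm
  have h3 := tendsto_nhds_unique h2 h1
  simpa [hL] using h3

/-- The numerator of the quotient rule is the Wronskian of F(t) and F(1 - t), evaluated by
Legendre's relation. -/
theorem hasDerivAt_ellRatio {t : ℝ} (ht : t ∈ Ioo (0 : ℝ) 1) :
    HasDerivAt ellRatio (-(1 / (π * (t * (1 - t) * ellF t ^ 2)))) t := by
  have h0 : t ≠ 0 := ht.1.ne'
  have h1 : 1 - t ≠ 0 := by linarith [ht.2]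
  have hF : ellF t ≠ 0 := (ellF_pos ht.1.le ht.2).ne'
  refine ((hasDerivAt_ellF_one_sub ht).div (hasDerivAt_ellF (abs_lt_one_of_mem_Ioo ht))
    hF).congr_deriv ?_
  have h := ellG_legendre ht
  rw [← div_div, ← h]
  field_simp
  ring

theorem ellRatio_injOn : InjOn ellRatio (Ioo 0 1) := by
  refine StrictAntiOn.injOn (strictAntiOn_of_deriv_neg (convex_Ioo 0 1) (fun t ht =>
    (hasDerivAt_ellRatio ht).continuousAt.continuousWithinAt) fun t ht => ?_)
  rw [interior_Ioo] at ht
  have h0 := ht.1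
  have h1 : 0 < 1 - t := by linarith [ht.2]
  have hF := ellF_pos ht.1.le ht.2
  rw [(hasDerivAt_ellRatio ht).deriv, neg_lt_zero]
  positivity

theorem ellRatio_pos {t : ℝ} (ht : t ∈ Ioo (0 : ℝ) 1) : 0 < ellRatio t :=
  div_pos (ellF_pos (by linarith [ht.2]) (by linarith [ht.1])) (ellF_pos ht.1.le ht.2)

theorem image_ellRatio : ellRatio '' Ioo 0 1 = Ioi 0 := by
  ext y
  constructor
  · rintro ⟨t, ht, rfl⟩
    exact ellRatio_pos ht
  · exact fun hy => ⟨lambdaIm y, lambdaIm_mem hy, ellRatio_lambdaIm hy⟩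

theorem etaPow_ellRatio {t : ℝ} (ht : t ∈ Ioo (0 : ℝ) 1) :
    etaPow (Complex.I * ellRatio t) = (t * (1 - t) * ellF t ^ 6 / 16 : ℝ) := by
  have hy := ellRatio_pos ht
  set y := ellRatio t with hyt
  have hl : lambdaIm y = t :=
    ellRatio_injOn (lambdaIm_mem hy) ht (by rw [ellRatio_lambdaIm hy])
  have hF := ellF_lambdaIm hy
  rw [hl] at hF
  have h1 := thetaA_pos hy
  rw [etaPow_I_mul hy, hF]
  congr 1
  have h2 := thetaA_sq hy
  have h3 : thetaB y ^ 2 = (1 - t) * thetaA y ^ 2 := by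
    rw [← hl, lambdaIm]
    field_simp
    ring
  have h4 : thetaB (1 / y) ^ 2 = t * (y ^ 2 * thetaA y ^ 2) := by
    rw [h3] at h2
    linarith
  rw [mul_pow, mul_pow, div_pow, h3, h4]
  field_simp

/-- Substitute y = F(1-t)/F(t): the integrand t(1-t)F(t)⁶/16 · y², times |dy/dt| = 1/(π
t(1-t)F(t)²), collapses to W²/(16π). -/
theorem etaMellin_three : etaMellin 3 = (1 / (16 * π) * ∫ t in (0 : ℝ)..1, ellW t ^ 2 : ℝ) := by
  have h := integral_etaPow_mul_pow 2
  rw [← image_ellRatio, integral_image_eq_integral_abs_deriv_smul measurableSet_Ioo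
    (fun t ht => (hasDerivAt_ellRatio ht).hasDerivWithinAt) ellRatio_injOn] at h
  have e : ((2 : ℕ) : ℂ) + 1 = 3 := by norm_num
  rw [e] at h
  rw [← h, intervalIntegral.integral_of_le zero_le_one, integral_Ioc_eq_integral_Ioo,
    ← integral_const_mul, ← integral_complex_ofReal]
  refine setIntegral_congr_fun measurableSet_Ioo fun t ht => ?_
  have h0 := ht.1
  have h1 : 0 < 1 - t := by linarith [ht.2]
  have hF := ellF_pos ht.1.le ht.2
  rw [etaPow_ellRatio ht, abs_neg, abs_of_pos (by positivity), Complex.real_smul]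
  norm_cast
  rw [ellRatio, ellW]
  field_simp

/-! ### The L-value -/

theorem etaTwoPowTwelve_I_mul {x : ℝ} (hx : 0 < x) :
    etaTwoPowTwelve (ofComplex (Complex.I * x)) = etaPow (Complex.I * ((2 * x : ℝ) : ℂ)) := by
  have him : 0 < (Complex.I * (x : ℂ)).im := by simpa using hx
  rw [etaTwoPowTwelve, ofComplex_apply_of_im_pos him, I_mul_two_mul]
  rfl

theorem lIntegralConverges_etaTwoPowTwelve {s : ℂ} (hs : 0 < s.re) :
    LIntegralConverges etaTwoPowTwelve s := by
  have h := (MellinConvergent.comp_mul_left (a := 2) two_pos).2 (mellinConvergent_etaPow hs)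
  refine h.congr_fun (fun x hx => ?_) measurableSet_Ioi
  simp only
  rw [etaTwoPowTwelve_I_mul hx]

theorem mellin_etaTwoPowTwelve (s : ℂ) :
    mellin (fun x : ℝ => etaTwoPowTwelve (ofComplex (Complex.I * x))) s =
      2 ^ (-s) * etaMellin s := by
  have h := mellin_comp_mul_left (fun y : ℝ => etaPow (Complex.I * y)) s two_pos
  rw [smul_eq_mul, Complex.ofReal_ofNat] at h
  rw [etaMellin, ← h]
  refine setIntegral_congr_fun measurableSet_Ioi fun x hx => ?_
  simp only
  rw [etaTwoPowTwelve_I_mul hx]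

/-- The constant is (2π)⁵/4! · 2⁻⁵ · 3/2 · 1/(16π) · π²/4 = π⁶/1024: Gamma factor, rescaling by 2,
period relation, substitution, Parseval. -/
theorem lValue_etaTwoPowTwelve :
    LValue etaTwoPowTwelve 5 =
      (π ^ 6 / 1024 * ∑' n : ℕ, halfCoeff n ^ 8 * (1 + 4 * n) : ℝ) := by
  have hΓ : Complex.Gamma 5 = 24 := by
    have := Complex.Gamma_nat_eq_factorial 4
    rw [show ((4 : ℕ) : ℂ) + 1 = 5 by norm_num] at this
    rw [this]
    norm_num [Nat.factorial]
  have h5 : (2 * (π : ℂ)) ^ (5 : ℂ) = (2 * (π : ℂ)) ^ 5 := by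
    rw [← Complex.cpow_natCast]; norm_num
  have h2 : (2 : ℂ) ^ (-5 : ℂ) = 1 / 32 := by
    rw [Complex.cpow_neg, show (5 : ℂ) = ((5 : ℕ) : ℂ) by norm_num, Complex.cpow_natCast]
    norm_num
  have h3 := two_mul_etaMellin_five
  have hπ : (π : ℂ) ≠ 0 := by exact_mod_cast Real.pi_ne_zero
  rw [LValue, mellin_etaTwoPowTwelve, hΓ, h5, h2, hasSum_halfCoeff_pow_eight.tsum_eq]
  rw [etaMellin_three] at h3
  push_cast at h3 ⊢
  field_simp at h3 ⊢
  linear_combination 1024 * h3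

/-! ### Pochhammer symbols and the hypergeometric form of the series. -/

theorem risingFactorial_succ (a : ℂ) (n : ℕ) :
    risingFactorial a (n + 1) = risingFactorial a n * (a + n) := by
  rw [risingFactorial, risingFactorial, ascPochhammer_succ_eval]

theorem risingFactorial_zero (a : ℂ) : risingFactorial a 0 = 1 := by
  simp [risingFactorial]

theorem risingFactorial_one (n : ℕ) : risingFactorial 1 n = (n ! : ℂ) := by
  rw [risingFactorial, ascPochhammer_eval_one]

theorem risingFactorial_half (n : ℕ) :
    risingFactorial (1 / 2) n = halfCoeff n * (n ! : ℂ) := by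
  induction n with
  | zero => simp [risingFactorial_zero, halfCoeff_zero]
  | succ n ih =>
    have h : ((n : ℂ) + 1) * (halfCoeff (n + 1) : ℂ) = (n + 1 / 2) * halfCoeff n := by
      have := congrArg Complex.ofReal (succ_mul_halfCoeff_succ n)
      push_cast at this
      exact this
    rw [risingFactorial_succ, ih, Nat.factorial_succ]
    push_cast
    linear_combination -(n ! : ℂ) * h

theorem risingFactorial_five_fourths (n : ℕ) :
    risingFactorial (5 / 4) n = (1 + 4 * n) * risingFactorial (1 / 4) n := by
  induction n with
  | zero => simp [risingFactorial_zero]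
  | succ n ih =>
    rw [risingFactorial_succ, risingFactorial_succ, ih]
    push_cast
    ring

theorem risingFactorial_one_fourth_ne_zero (n : ℕ) : risingFactorial (1 / 4) n ≠ 0 := by
  induction n with
  | zero => simp [risingFactorial_zero]
  | succ n ih =>
    rw [risingFactorial_succ]
    refine mul_ne_zero ih ?_
    rw [show (1 / 4 + n : ℂ) = ((1 / 4 + n : ℝ) : ℂ) by push_cast; ring]
    exact_mod_cast (show (1 / 4 + n : ℝ) ≠ 0 by positivity)

theorem risingFactorial_div_pow_eight (n : ℕ) :
    risingFactorial (1 / 2) n ^ 8 / risingFactorial 1 n ^ 8 * (1 + 4 * (n : ℂ)) =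
      (halfCoeff n ^ 8 * (1 + 4 * n) : ℝ) := by
  have h : (n ! : ℂ) ≠ 0 := by exact_mod_cast n.factorial_ne_zero
  rw [risingFactorial_half, risingFactorial_one]
  push_cast
  field_simp

/-- Seven lower parameters equal to 1 and the n! of the series make up the eighth power of (1)_n;
the parameters 5/4 and 1/4 produce 1 + 4n. -/
theorem hypergeometricTerm_eq (n : ℕ) :
    hypergeometricTerm {1 / 2, 1 / 2, 1 / 2, 1 / 2, 1 / 2, 1 / 2, 1 / 2, 1 / 2, 5 / 4}
      {1, 1, 1, 1, 1, 1, 1, 1 / 4} 1 n =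
    risingFactorial (1 / 2) n ^ 8 / risingFactorial 1 n ^ 8 * (1 + 4 * (n : ℂ)) := by
  have h : (n ! : ℂ) ≠ 0 := by exact_mod_cast n.factorial_ne_zero
  have h4 := risingFactorial_one_fourth_ne_zero n
  simp only [hypergeometricTerm, Multiset.insert_eq_cons, Multiset.map_cons,
    Multiset.map_singleton, Multiset.prod_cons, Multiset.prod_singleton, one_pow]
  rw [risingFactorial_five_fourths, risingFactorial_one]
  field_simp

theorem mainTheorem7 :
    LIntegralConverges etaTwoPowTwelve 5 ∧
    Summable (fun n : ℕ =>
      risingFactorial (1 / 2) n ^ 8 / risingFactorial 1 n ^ 8 * (1 + 4 * (n : ℂ))) ∧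
    Summable (hypergeometricTerm
      {1 / 2, 1 / 2, 1 / 2, 1 / 2, 1 / 2, 1 / 2, 1 / 2, 1 / 2, 5 / 4}
      {1, 1, 1, 1, 1, 1, 1, 1 / 4} 1) ∧
    LValue etaTwoPowTwelve 5 =
      (π : ℂ) ^ 6 / 1024 * ∑' n : ℕ,
        risingFactorial (1 / 2) n ^ 8 / risingFactorial 1 n ^ 8 * (1 + 4 * (n : ℂ)) ∧
    LValue etaTwoPowTwelve 5 =
      (π : ℂ) ^ 6 / 1024 * hypergeometricPFQ
        {1 / 2, 1 / 2, 1 / 2, 1 / 2, 1 / 2, 1 / 2, 1 / 2, 1 / 2, 5 / 4}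
        {1, 1, 1, 1, 1, 1, 1, 1 / 4} 1 := by
  have hs : Summable (fun n : ℕ =>
      risingFactorial (1 / 2) n ^ 8 / risingFactorial 1 n ^ 8 * (1 + 4 * (n : ℂ))) := by
    simp only [risingFactorial_div_pow_eight]
    exact Complex.ofRealCLM.summable hasSum_halfCoeff_pow_eight.summable
  have hL : LValue etaTwoPowTwelve 5 = (π : ℂ) ^ 6 / 1024 * ∑' n : ℕ,
      risingFactorial (1 / 2) n ^ 8 / risingFactorial 1 n ^ 8 * (1 + 4 * (n : ℂ)) := by
    rw [lValue_etaTwoPowTwelve]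
    simp only [risingFactorial_div_pow_eight]
    push_cast
    rfl
  refine ⟨lIntegralConverges_etaTwoPowTwelve (by norm_num), hs, ?_, hL, ?_⟩
  · exact hs.congr fun n => (hypergeometricTerm_eq n).symm
  · rw [hL, hypergeometricPFQ]
    simp only [hypergeometricTerm_eq]

end
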